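/- **Setting.** Consider a controlled Markov process with terminal states, of one of the following two kinds. (a) *Controlled diffusion.* The state lives in $\mathbb{R}^n$ and, until a closed set $F$ of terminal states is reached, evolves by $$dX(t)=\mu(X(t),u(t))\,dt+\sigma(X(t),u(t))\,dW(t),$$ where $\mu$ and $\sigma$ (vector- and $n\times n$-matrix-valued) are continuous and $u(t)$ takes values in a Borel set $U\subseteq\mathbb{R}^m$ of actions; from the moment it reaches $F$, the state is frozen. A *future course* from $x$ is a weak solution of this equation: a filtered probability space with a bounded progressively measurable $U$-valued action process $u$ and an adapted continuous process $X$ with $X(0)=x$ almost surely, frozen in $F$, such that for every $f\in C_c^\infty(\mathbb{R}^n)$ the process $f(X(t))-f(X(0))-\int_0^t \mathbf 1_{\{X(r)\notin F\}}L^{u(r)}f(X(r))\,dr$ is a martingale, where $L^{u}f(y)=\sum_i\mu_i(y,u)\,\partial_i f(y)+\tfrac12\sum_{i,j}(\sigma\sigma^{T})_{ij}(y,u)\,\partial_i\partial_j f(y)$. (Feedback policies $u(t)=\pi(X(t),t)$ and deterministic $u$ are special cases.) Time is $t\in[0,\infty)$ and a horizon is $h\in[0,\infty]$. (b) *Discrete-time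 Markov decision process.* The state space and the action space are standard Borel spaces, $p(\cdot\mid x,u)$ is a Markov transition kernel, and the states of a measurable set $F$ are terminal (absorbing). A *future course* from $x$ is a filtered probability space with adapted sequences of states $X_k$ and actions $u_k$ such that $X_0=x$ almost surely and, given the past up to time $k$, the state $X_{k+1}$ has the law $p(\cdot\mid X_k,u_k)$ if $X_k\notin F$ and equals $X_k$ if $X_k\in F$. Time is $t\in\{0,1,2,\dots\}$ and a horizon is $h\in\{0,1,2,\dots\}\cup\{\infty\}$. Let $B\subseteq F$ be a Borel set of terminal states (those that admit the event $B$). The event $B$ *occurs within* $h$ if $X(t)\in B$ for some time $t\le h$. The *reachability* $\Lambda_B(h,x)\in[0,1]$ of $B$ from the state $x$ with remaining time $h$ is the greatest probability (supremum) that $B$ occurs within $h$, over all future courses from $x$. (For $h=\infty$ it is a function of the state alone, and $\infty-t=\infty$.) **Proposition 2 (Null Proposition).** For every horizon $h$ and every state $x$, in both settings: 1. If $\Lambda_B(h,x)=0$, then for every future course from $x$, with probability one the reachability remains zero: almost surely $\Lambda_B(h-t,X(t))=0$ for all times $t\le h$ simultaneously. 2. $\Lambda_B(h,x)=0$ if and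 only if $B$ almost surely never occurs from $x$ within the horizon, regardless of future actions and stochasticity, that is: for every future course from $x$, almost surely $X(t)\notin B$ for all times $t\le h$. -/

import Mathlib

open MeasureTheory ProbabilityTheory
open scoped NNReal ENNReal

/-- The data of a controlled diffusion
`dX(t) = μ(X(t), u(t)) dt + σ(X(t), u(t)) dW(t)` on `ℝⁿ`, with actions `u(t) ∈ U ⊆ ℝᵐ`,
stationary continuous coefficients, and a closed set of terminal states. -/
structure ControlledDiffusion (n m : ℕ) where
  /-- the drift `μ(x, u)` -/
  drift : EuclideanSpace ℝ (Fin n) → EuclideanSpace ℝ (Fin m) → EuclideanSpace ℝ (Fin n)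
  /-- the diffusion matrix `σ(x, u)` -/
  diffusion : EuclideanSpace ℝ (Fin n) → EuclideanSpace ℝ (Fin m) → Matrix (Fin n) (Fin n) ℝ
  /-- the set of possible actions -/
  actions : Set (EuclideanSpace ℝ (Fin m))
  /-- the set of terminal states: the trajectory ends when it reaches one of them -/
  terminal : Set (EuclideanSpace ℝ (Fin n))
  continuous_drift : Continuous (Function.uncurry drift)
  continuous_diffusion : Continuous (Function.uncurry diffusion)
  measurableSet_actions : MeasurableSet actions
  isClosed_terminal : IsClosed terminal

namespace ControlledDiffusion

variable {n m : ℕ}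

/-- The second order operator of the diffusion under the action `u`:
`L^u f (x) = ∑ᵢ μᵢ(x,u) ∂ᵢ f(x) + ½ ∑ᵢⱼ (σ σᵀ)ᵢⱼ(x,u) ∂ᵢ∂ⱼ f(x)`. -/
noncomputable def generator (D : ControlledDiffusion n m) (u : EuclideanSpace ℝ (Fin m))
    (f : EuclideanSpace ℝ (Fin n) → ℝ) (x : EuclideanSpace ℝ (Fin n)) : ℝ :=
  fderiv ℝ f x (D.drift x u) +
    (1 / 2) * ∑ i : Fin n, ∑ j : Fin n,
      (D.diffusion x u * (D.diffusion x u).transpose) i j *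
        iteratedFDeriv ℝ 2 f x
          ![EuclideanSpace.single i (1 : ℝ), EuclideanSpace.single j (1 : ℝ)]

/-- A future course of the controlled diffusion `D` from the state `x`, on a probability space
`(Ω, P)` with a filtration: a non-anticipative bounded action process `u` with values in the
action set, and a state process `X` with continuous paths that starts at `x`, is frozen from the
moment it reaches a terminal state, and until then solves the stochastic differential equation
driven by `u`, in the weak sense, i.e. it solves the martingale problem for `L^{u(t)}`.
For a policy `π`, the choice `u(t) = π(X(t), t)` is a special case, and so is a
deterministic `u`. -/
structure Course (D : ControlledDiffusion n m) (x : EuclideanSpace ℝ (Fin n))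
    {Ω : Type} [mΩ : MeasurableSpace Ω] (P : Measure Ω) where
  isProbabilityMeasure : IsProbabilityMeasure P
  /-- the filtration: what is known at each time -/
  filtration : Filtration ℝ≥0 mΩ
  /-- the action process -/
  u : ℝ≥0 → Ω → EuclideanSpace ℝ (Fin m)
  /-- the state process -/
  X : ℝ≥0 → Ω → EuclideanSpace ℝ (Fin n)
  progressive_u : IsStronglyProgressive filtration u
  u_mem : ∀ t ω, u t ω ∈ D.actions
  u_bounded : ∃ C : ℝ, ∀ t ω, ‖u t ω‖ ≤ C
  adapted_X : StronglyAdapted filtration X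
  continuous_X : ∀ ω, Continuous fun t => X t ω
  initial : ∀ᵐ ω ∂P, X 0 ω = x
  absorbed : ∀ᵐ ω ∂P, ∀ s t : ℝ≥0, s ≤ t → X s ω ∈ D.terminal → X t ω = X s ω
  martingale : ∀ f : EuclideanSpace ℝ (Fin n) → ℝ, ContDiff ℝ ((⊤ : ℕ∞) : WithTop ℕ∞) f → HasCompactSupport f →
    Martingale
      (fun (t : ℝ≥0) ω => f (X t ω) - f (X 0 ω) -
        ∫ r in (0 : ℝ)..(t : ℝ),
          D.terminalᶜ.indicator (D.generator (u r.toNNReal ω) f) (X r.toNNReal ω))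
      filtration P

/-- The event that `B` occurs before or at the end of the horizon `h` (possibly `h = ∞`), where
`B` is given by the set of (terminal) states that admit it. As terminal states absorb, this means
that the trajectory reaches `B` by time `h` and no other terminal state before. -/
def Course.occurs {D : ControlledDiffusion n m} {x : EuclideanSpace ℝ (Fin n)}
    {Ω : Type} [MeasurableSpace Ω] {P : Measure Ω} (S : D.Course x P)
    (B : Set (EuclideanSpace ℝ (Fin n))) (h : ℝ≥0∞) : Set Ω :=
  {ω | ∃ t : ℝ≥0, (t : ℝ≥0∞) ≤ h ∧ S.X t ω ∈ B}

/-- The reachability `Λ_B(x)` with remaining time `h`: the greatest probability (supremum) that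
`B` occurs from `x` within `h`, over all future courses. -/
noncomputable def reachability (D : ControlledDiffusion n m)
    (B : Set (EuclideanSpace ℝ (Fin n))) (h : ℝ≥0∞) (x : EuclideanSpace ℝ (Fin n)) : ℝ≥0∞ :=
  ⨆ (Ω : Type) (_ : MeasurableSpace Ω) (P : Measure Ω) (S : D.Course x P), P (S.occurs B h)

end ControlledDiffusion

/-- The data of a discrete-time Markov decision process with state space `E` and action space
`A`: a transition kernel `p(· | x, u)` and a set of terminal states. -/
structure DiscreteMDP (E A : Type) [MeasurableSpace E] [MeasurableSpace A] where
  /-- the transition kernel -/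
  transition : Kernel (E × A) E
  isMarkovKernel_transition : IsMarkovKernel transition
  /-- the set of terminal states: the trajectory ends when it reaches one of them -/
  terminal : Set E
  measurableSet_terminal : MeasurableSet terminal

namespace DiscreteMDP

variable {E A : Type} [MeasurableSpace E] [MeasurableSpace A]

open Classical in
/-- The law of the next state after the state `x` and the action `u`; terminal states absorb. -/
noncomputable def step (M : DiscreteMDP E A) (x : E) (u : A) : Measure E :=
  if x ∈ M.terminal then Measure.dirac x else M.transition (x, u)

/-- A future course of the process from the state `x`, on a probability space `(Ω, P)` with a
filtration: a non-anticipative action sequence `u` and a state sequence `X` that starts at `x`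
and whose next state has, given the past, the law `M.step (X k) (u k)`.
For a policy `π`, the choice `u k = π (X k, k)` is a special case. -/
structure Course (M : DiscreteMDP E A) (x : E)
    {Ω : Type} [mΩ : MeasurableSpace Ω] (P : Measure Ω) where
  isProbabilityMeasure : IsProbabilityMeasure P
  /-- the filtration: what is known at each time -/
  filtration : Filtration ℕ mΩ
  /-- the action sequence -/
  u : ℕ → Ω → A
  /-- the state sequence -/
  X : ℕ → Ω → E
  adapted_u : Adapted filtration u
  adapted_X : Adapted filtration X
  initial : ∀ᵐ ω ∂P, X 0 ω = x
  transition : ∀ (k : ℕ) (C : Set E), MeasurableSet C →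
    P[(X (k + 1) ⁻¹' C).indicator (fun _ => (1 : ℝ)) | filtration k]
      =ᵐ[P] fun ω => (M.step (X k ω) (u k ω)).real C

/-- The event that `B` occurs before or at the end of the horizon `h` (possibly `h = ∞`). -/
def Course.occurs {M : DiscreteMDP E A} {x : E}
    {Ω : Type} [MeasurableSpace Ω] {P : Measure Ω} (S : M.Course x P)
    (B : Set E) (h : ℕ∞) : Set Ω :=
  {ω | ∃ k : ℕ, (k : ℕ∞) ≤ h ∧ S.X k ω ∈ B}

/-- The reachability `Λ_B(x)` with remaining time `h`: the greatest probability (supremum) that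
`B` occurs from `x` within `h`, over all future courses. -/
noncomputable def reachability (M : DiscreteMDP E A) (B : Set E) (h : ℕ∞) (x : E) : ℝ≥0∞ :=
  ⨆ (Ω : Type) (_ : MeasurableSpace Ω) (P : Measure Ω) (S : M.Course x P), P (S.occurs B h)

end DiscreteMDP

/-! The second part is immediate, because a supremum of probabilities vanishes exactly if each of
them does. The first part holds because courses can be continued. Suppose that along a course `S`
from `x` the reachability is positive at some time, on a set of positive outer measure. Following
`S` up to such a time, and then a course that witnesses the positive reachability, gives a course
from `x` in which `B` occurs with positive probability, a contradiction. Two points need work: the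
time and the continuation have to be chosen measurably and without anticipation, and the
concatenation has to be a course again.

Selection. Courses live on arbitrary probability spaces, so they are replaced by their laws on a
path space `W`. By `exists_kernel_attaining`, one kernel `κ` attains all laws as its parameter `z`
varies. The triples (time, state, `z`) for which `κ z` is the law of a course from that state that
reaches `B` within the remaining time form a Borel set. Its projection to time and state is only
analytic. By `exists_compact_hit`, it contains a compact set that the process still hits with
positive probability; the first hitting time of this set is a stopping time, and over it `z` has a
Borel choice (`exists_stopping_selection`). Measurability of the reachability is never needed.

Laws. In discrete time the sequence of states and actions is the path. For a diffusion, the path of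
states is paired with the integral of the actions, and the action is recovered as a derivative from
the left (`Course.exists_isControlled`). To be the law of a solution is a measurable condition
because countably many test functions, times and events suffice.

Concatenation. On `Ω × W` with the measure `P ⊗ₘ η`, the process follows the first component until
the stopping time `T` and the second from then on, and `gluedFiltration` reveals them accordingly.
In `IsControlled.glue`, the functional of the martingale problem splits at `T` into a stopped
martingale of the old course and, on each fibre, a martingale of the new one. In discrete time it is
enough to treat one fixed time, and `Course.exists_glue` verifies the transition law. -/

/-! ### The space of continuous paths -/

section PathSpace

variable {V : Type*} [NormedAddCommGroup V]

/-- The Borel σ-algebra of the space of continuous paths. -/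
noncomputable instance pathMeasurableSpace : MeasurableSpace C(ℝ≥0, V) := borel _

instance pathBorelSpace : BorelSpace C(ℝ≥0, V) := ⟨rfl⟩

/-- The path stopped at time `s`. -/
def stopPath (s : ℝ≥0) (w : C(ℝ≥0, V)) : C(ℝ≥0, V) :=
  w.comp ⟨fun r => min r s, by fun_prop⟩

@[simp] lemma stopPath_apply (s : ℝ≥0) (w : C(ℝ≥0, V)) (r : ℝ≥0) :
    stopPath s w r = w (min r s) := rfl

lemma measurable_stopPath (s : ℝ≥0) : Measurable (stopPath s : C(ℝ≥0, V) → C(ℝ≥0, V)) :=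
  (ContinuousMap.continuous_precomp _).measurable

lemma stopPath_stopPath {s t : ℝ≥0} (h : s ≤ t) (w : C(ℝ≥0, V)) :
    stopPath s (stopPath t w) = stopPath s w := by
  ext r
  simp [min_assoc, min_eq_left h]

/-- The canonical filtration of the path space: the path up to time `s` is known at time `s`. -/
noncomputable def pathFiltration (V : Type*) [NormedAddCommGroup V] :
    Filtration ℝ≥0 (pathMeasurableSpace : MeasurableSpace C(ℝ≥0, V)) where
  seq s := MeasurableSpace.comap (stopPath s) pathMeasurableSpace
  mono' := by
    rintro s t hst _ ⟨C, hC, rfl⟩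
    refine ⟨stopPath s ⁻¹' C, measurable_stopPath s hC, ?_⟩
    ext w
    simp [stopPath_stopPath hst]
  le' s := (measurable_stopPath s).comap_le

variable [MeasurableSpace V] [BorelSpace V]

lemma measurable_pathFiltration_eval {r s : ℝ≥0} (h : r ≤ s) :
    Measurable[pathFiltration V s] fun w : C(ℝ≥0, V) => w r := by
  have h1 : (fun w : C(ℝ≥0, V) => w r) = (fun w : C(ℝ≥0, V) => w r) ∘ stopPath s := by
    ext w
    simp [min_eq_left h]
  rw [h1]
  exact (continuous_eval_const r).measurable.comp (comap_measurable _)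

variable [SecondCountableTopology V]

lemma measurable_path_eval_uncurry :
    Measurable fun p : ℝ≥0 × C(ℝ≥0, V) => p.2 p.1 := by
  have h : Continuous fun p : ℝ≥0 × C(ℝ≥0, V) => p.2 p.1 := by fun_prop
  exact h.measurable

lemma stronglyAdapted_path_eval :
    StronglyAdapted (pathFiltration V) fun (r : ℝ≥0) (w : C(ℝ≥0, V)) => w r :=
  fun _ => (measurable_pathFiltration_eval le_rfl).stronglyMeasurable

variable [CompleteSpace V]

/-- A family of paths depends measurably on a parameter if all its evaluations do. -/
lemma measurable_path_iff {Ω : Type*} {mΩ : MeasurableSpace Ω} {f : Ω → C(ℝ≥0, V)} :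
    Measurable f ↔ ∀ r, Measurable fun ω => f ω r := by
  refine ⟨fun h r => (continuous_eval_const r).measurable.comp h, fun h => ?_⟩
  let e : C(ℝ≥0, V) → ℕ → V := fun w k => w (TopologicalSpace.denseSeq ℝ≥0 k)
  have he : Continuous e := continuous_pi fun k => continuous_eval_const _
  have hinj : Function.Injective e := by
    intro w w' hw
    refine DFunLike.coe_injective
      ((TopologicalSpace.denseRange_denseSeq ℝ≥0).equalizer w.continuous w'.continuous ?_)
    ext k
    exact congrFun hw k
  -- By the Lusin–Souslin theorem, a continuous injection of a Polish space is a measurable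
  -- embedding, so countably many evaluations generate the Borel sets.
  refine (he.measurableEmbedding hinj).measurable_comp_iff.1 ?_
  exact measurable_pi_lambda _ fun k => h _

/-- The path of an adapted continuous process up to time `s` is known at time `s`. -/
lemma measurable_path_of_adapted {Ω : Type*} {mΩ : MeasurableSpace Ω} (F : Filtration ℝ≥0 mΩ)
    {Y : Ω → C(ℝ≥0, V)} (hY : ∀ r, Measurable[F r] fun ω => Y ω r) (s : ℝ≥0) :
    Measurable[F s, pathFiltration V s] Y := by
  rintro _ ⟨C, hC, rfl⟩
  have h : Measurable[F s] fun ω => stopPath s (Y ω) := by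
    refine (measurable_path_iff (mΩ := F s)).2 fun r => ?_
    exact (hY (min r s)).mono (F.mono (min_le_right _ _)) le_rfl
  exact h hC

end PathSpace

/-! ### A kernel that attains all laws -/

/-- The measure on the line with a given distribution function on the rationals, if it is one. -/
noncomputable def ratCDFKernel : Kernel (ℚ → ℝ) ℝ where
  toFun z := ((isMeasurableRatCDF_toRatCDF (f := fun z : ℚ → ℝ => z)
    measurable_id).stieltjesFunction z).measure
  measurable' := by
    refine StieltjesFunction.measurable_measure ?_ ?_ ?_
    · exact IsMeasurableRatCDF.measurable_stieltjesFunction _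
    · exact IsMeasurableRatCDF.tendsto_stieltjesFunction_atBot _
    · exact IsMeasurableRatCDF.tendsto_stieltjesFunction_atTop _

instance : IsMarkovKernel ratCDFKernel where
  isProbabilityMeasure z := StieltjesFunction.isProbabilityMeasure _
    (IsMeasurableRatCDF.tendsto_stieltjesFunction_atBot _ z)
    (IsMeasurableRatCDF.tendsto_stieltjesFunction_atTop _ z)

/-- The distribution function of `μ`, restricted to the rationals, already has all the properties
that `toRatCDF` enforces, so it is left unchanged and gives back `μ`. -/
lemma exists_ratCDFKernel_eq (μ : Measure ℝ) [IsProbabilityMeasure μ] :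
    ∃ z, ratCDFKernel z = μ := by
  let z : ℚ → ℝ := fun q => cdf μ q
  have hz : IsRatStieltjesPoint (fun z : ℚ → ℝ => z) z := by
    refine ⟨fun q r h => monotone_cdf μ (by exact_mod_cast h),
      (tendsto_cdf_atTop μ).comp (tendsto_ratCast_atTop_iff.2 Filter.tendsto_id),
      (tendsto_cdf_atBot μ).comp (tendsto_ratCast_atBot_iff.2 Filter.tendsto_id), fun t => ?_⟩
    rw [show z t = cdf μ (t : ℝ) from rfl, ← (cdf μ).iInf_rat_gt_eq]
    refine Equiv.iInf_congr (Equiv.subtypeEquivRight fun r => ?_) fun r => rfl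
    simp
  refine ⟨z, ?_⟩
  set hf := isMeasurableRatCDF_toRatCDF (f := fun z : ℚ → ℝ => z) measurable_id
  have h : hf.stieltjesFunction z = cdf μ := by
    ext x
    rw [← StieltjesFunction.iInf_rat_gt_eq, ← (cdf μ).iInf_rat_gt_eq]
    refine iInf_congr fun r => ?_
    rw [hf.stieltjesFunction_eq, toRatCDF_of_isRatStieltjesPoint hz]
  change (hf.stieltjesFunction z).measure = μ
  rw [h, measure_cdf]

/-- There is a kernel from a Polish space that attains all probability measures. -/
lemma exists_kernel_attaining (W : Type*) [MeasurableSpace W] [StandardBorelSpace W] :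
    ∃ κ : Kernel (ℚ → ℝ) W, IsFiniteKernel κ ∧
      ∀ μ : Measure W, IsProbabilityMeasure μ → ∃ z, κ z = μ := by
  have he := measurableEmbedding_embeddingReal W
  refine ⟨ratCDFKernel.comapRight he, inferInstance, fun μ hμ => ?_⟩
  have := Measure.isProbabilityMeasure_map (μ := μ) he.measurable.aemeasurable
  obtain ⟨z, hz⟩ := exists_ratCDFKernel_eq (μ.map (embeddingReal W))
  refine ⟨z, ?_⟩
  rw [Kernel.comapRight_apply, hz, he.comap_map]

/-! ### Selection at a hitting time -/

/-- A continuous map from a compact metrizable space has a measurable section. -/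
lemma exists_measurable_section_of_compact {K Y : Type*} [TopologicalSpace K] [CompactSpace K]
    [TopologicalSpace.MetrizableSpace K] [Nonempty K] [MeasurableSpace K] [BorelSpace K]
    [TopologicalSpace Y] [T2Space Y] [MeasurableSpace Y] [OpensMeasurableSpace Y]
    {h : K → Y} (hh : Continuous h) :
    ∃ g : Y → K, Measurable g ∧ ∀ y ∈ Set.range h, h (g y) = y := by
  classical
  let := TopologicalSpace.metrizableSpaceMetric K
  obtain ⟨f, hf, hfs⟩ := exists_nat_bool_continuous_surjective_of_compact K
  let e : cantorSet → K := f ∘ cantorSetHomeomorphNatToBool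
  have he : Continuous e := hf.comp cantorSetHomeomorphNatToBool.continuous
  have hes : Function.Surjective e := hfs.comp cantorSetHomeomorphNatToBool.surjective
  have : CompactSpace cantorSet := isCompact_iff_compactSpace.1 isCompact_cantorSet
  -- Pulled back to the Cantor set, the fibres of `h` are compact sets of reals, and their least
  -- points are a canonical choice.
  let S : Y → Set ℝ := fun y => Subtype.val '' {x : cantorSet | h (e x) = y}
  have hSc : ∀ y, IsCompact (S y) := fun y =>
    ((isClosed_singleton.preimage (hh.comp he)).isCompact).image continuous_subtype_val
  have hSm : ∀ y ∈ Set.range h, sInf (S y) ∈ S y := by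
    rintro y ⟨k, rfl⟩
    obtain ⟨x, rfl⟩ := hes k
    exact (hSc _).sInf_mem ⟨x, x, rfl, rfl⟩
  have hR : MeasurableSet (Set.range h) := (isCompact_range hh).isClosed.measurableSet
  have hm : Measurable fun y : Set.range h => sInf (S y) := by
    refine measurable_of_Iic fun c => ?_
    -- The sublevel sets of the least point are images of compact sets, hence closed.
    have : (fun y : Set.range h => sInf (S y)) ⁻¹' Set.Iic c
        = Subtype.val ⁻¹' ((h ∘ e) '' {x : cantorSet | (x : ℝ) ≤ c}) := by
      ext ⟨y, hy⟩
      simp only [Set.mem_preimage, Set.mem_Iic, Set.mem_image, Set.mem_ofPred_eq]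
      constructor
      · intro hc
        obtain ⟨x, hx, hx'⟩ := hSm y hy
        exact ⟨x, by rwa [hx'], hx⟩
      · rintro ⟨x, hx, hx'⟩
        exact (csInf_le (hSc y).bddBelow ⟨x, hx', rfl⟩).trans hx
    rw [this]
    exact measurable_subtype_coe (((isClosed_le continuous_subtype_val
      continuous_const).isCompact.image (hh.comp he)).isClosed.measurableSet)
  have hmem : ∀ y : Set.range h, sInf (S y) ∈ cantorSet := by
    rintro ⟨y, hy⟩
    obtain ⟨x, -, hx⟩ := hSm y hy
    exact hx ▸ x.2
  let g₁ : Set.range h → K := fun y => e ⟨sInf (S y), hmem y⟩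
  have hg₁ : Measurable g₁ := he.measurable.comp (hm.subtype_mk)
  obtain ⟨k₀⟩ := ‹Nonempty K›
  refine ⟨fun y => if hy : y ∈ Set.range h then g₁ ⟨y, hy⟩ else k₀,
    Measurable.dite hg₁ measurable_const hR, fun y hy => ?_⟩
  simp only [hy, dif_pos]
  obtain ⟨x, hx, hx'⟩ := hSm y hy
  have : (⟨sInf (S y), hmem ⟨y, hy⟩⟩ : cantorSet) = x := Subtype.ext hx'.symm
  simp only [g₁, this]
  exact hx

lemma measurable_of_measurableSet_le {Ω : Type*} {mΩ : MeasurableSpace Ω}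
    (F : Filtration ℝ≥0 mΩ) {T : Ω → ℝ≥0∞} (hT : ∀ t : ℝ≥0, MeasurableSet[F t] {ω | T ω ≤ t}) :
    Measurable T := by
  refine measurable_of_Iic fun a => ?_
  rcases eq_or_ne a ⊤ with rfl | ha
  · simp
  · lift a to ℝ≥0 using ha
    exact F.le a _ (hT a)

section Hitting

variable {Ω E : Type*} [MetricSpace E] {X : ℝ≥0 → Ω → E}

/-- Whether a continuous process has hit a closed set of times and states by time `t` is known
at time `t`. -/
lemma measurableSet_hit {mΩ : MeasurableSpace Ω} [MeasurableSpace E] [BorelSpace E]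
    {t : ℝ≥0} (hX : ∀ s ≤ t, Measurable (X s)) (hc : ∀ ω, Continuous fun s => X s ω)
    {C : Set (ℝ≥0 × E)} (hC : IsClosed C) :
    MeasurableSet {ω | ∃ s ≤ t, (s, X s ω) ∈ C} := by
  rcases C.eq_empty_or_nonempty with rfl | hne
  · simp
  -- The distance to `C` along the process frozen at `t`. It uses only times up to `t`, can be
  -- sampled on a dense sequence, and attains its minimum, which is zero exactly if `C` is hit.
  let d : ℝ≥0 → Ω → ℝ := fun r ω => Metric.infDist (min r t, X (min r t) ω) C
  have hd : ∀ ω, Continuous fun r => d r ω := fun ω =>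
    (Metric.continuous_infDist_pt C).comp
      ((continuous_id.min continuous_const).prodMk ((hc ω).comp (continuous_id.min
        continuous_const)))
  have hdm : ∀ r, Measurable (d r) := fun r =>
    ((Metric.continuous_infDist_pt C).comp (Continuous.prodMk_right (min r t))).measurable.comp
      (hX _ (min_le_right _ _))
  have : {ω | ∃ s ≤ t, (s, X s ω) ∈ C}
      = ⋂ j : ℕ, ⋃ k : ℕ, {ω | d (TopologicalSpace.denseSeq ℝ≥0 k) ω < 1 / ((j : ℝ) + 1)} := by
    ext ω
    simp only [Set.mem_ofPred_eq, Set.mem_iInter, Set.mem_iUnion]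
    constructor
    · rintro ⟨s, hs, hsC⟩ j
      have hs0 : d s ω < 1 / ((j : ℝ) + 1) := by
        simp only [d, min_eq_left hs, Metric.infDist_zero_of_mem hsC]
        positivity
      exact (TopologicalSpace.denseRange_denseSeq ℝ≥0).exists_mem_open
        (isOpen_lt (hd ω) continuous_const) ⟨s, hs0⟩
    · intro h
      obtain ⟨s, hs, hmin⟩ := (isCompact_Icc (a := (0 : ℝ≥0)) (b := t)).exists_isMinOn
        ⟨0, by simp⟩ (hd ω).continuousOn
      refine ⟨s, hs.2, ?_⟩
      rw [hC.mem_iff_infDist_zero hne]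
      have hle : ∀ j : ℕ, d s ω ≤ 1 / ((j : ℝ) + 1) := by
        intro j
        obtain ⟨k, hk⟩ := h j
        have h1 := hmin (show min (TopologicalSpace.denseSeq ℝ≥0 k) t ∈ Set.Icc 0 t by simp)
        simp only [d, min_assoc, min_self, Set.mem_ofPred_eq] at h1 hk ⊢
        exact h1.trans hk.le
      have h0 : d s ω ≤ 0 := ge_of_tendsto' tendsto_one_div_add_atTop_nhds_zero_nat hle
      simp only [d, min_eq_left hs.2] at h0
      exact le_antisymm h0 Metric.infDist_nonneg
  rw [this]
  exact .iInter fun j => .iUnion fun k => measurableSet_lt (hdm _) measurable_const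

/-- The first time at which the process `X` and the clock are in `C`. -/
noncomputable def hitTime (X : ℝ≥0 → Ω → E) (C : Set (ℝ≥0 × E)) (ω : Ω) : ℝ≥0∞ :=
  ⨅ (s : ℝ≥0) (_ : (s, X s ω) ∈ C), (s : ℝ≥0∞)

/-- By continuity of the path, the set of times of hitting is closed, so its infimum is attained. -/
lemma hitTime_mem (hc : ∀ ω, Continuous fun s => X s ω) {C : Set (ℝ≥0 × E)} (hC : IsClosed C)
    {ω : Ω} (h : ∃ s, (s, X s ω) ∈ C) :
    ∃ s : ℝ≥0, hitTime X C ω = s ∧ (s, X s ω) ∈ C := by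
  have hcl : IsClosed {s | (s, X s ω) ∈ C} := hC.preimage (continuous_id.prodMk (hc ω))
  refine ⟨sInf {s | (s, X s ω) ∈ C}, le_antisymm ?_ ?_, hcl.csInf_mem h (OrderBot.bddBelow _)⟩
  · exact iInf₂_le _ (hcl.csInf_mem h (OrderBot.bddBelow _))
  · exact le_iInf₂ fun s hs => 
      ENNReal.coe_le_coe.2 (csInf_le (OrderBot.bddBelow _) hs)

/-- Reduces the stopping time property to `measurableSet_hit`, with no right-continuity of the
filtration. -/
lemma hitTime_le_iff (hc : ∀ ω, Continuous fun s => X s ω) {C : Set (ℝ≥0 × E)} (hC : IsClosed C)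
    {ω : Ω} {t : ℝ≥0} : hitTime X C ω ≤ t ↔ ∃ s ≤ t, (s, X s ω) ∈ C := by
  constructor
  · intro h
    by_cases hh : ∃ s, (s, X s ω) ∈ C
    · obtain ⟨s, hs, hsC⟩ := hitTime_mem hc hC hh
      exact ⟨s, by rw [hs] at h; exact_mod_cast h, hsC⟩
    · have : hitTime X C ω = ⊤ := by
        simp only [not_exists] at hh
        simp [hitTime, hh]
      simp [this] at h
  · rintro ⟨s, hs, hsC⟩
    exact (iInf₂_le s hsC).trans (by exact_mod_cast hs)

/-- An inner approximation in the manner of Choquet: if a continuous process hits the continuous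
image of the Baire space with positive probability, then it hits the image of a compact subset
with positive probability. -/
lemma exists_compact_hit {mΩ : MeasurableSpace Ω} {P : Measure Ω} [IsFiniteMeasure P]
    [MeasurableSpace E] [BorelSpace E] (hX : ∀ s, Measurable (X s))
    (hc : ∀ ω, Continuous fun s => X s ω)
    {π : (ℕ → ℕ) → ℝ≥0 × E} (hπ : Continuous π)
    (hpos : P {ω | ∃ t, (t, X t ω) ∈ Set.range π} ≠ 0) :
    ∃ K : Set (ℕ → ℕ), IsCompact K ∧ P {ω | ∃ t, (t, X t ω) ∈ π '' K} ≠ 0 := by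
  obtain ⟨N, hN⟩ : ∃ N : ℕ, P {ω | ∃ t ≤ (N : ℝ≥0), (t, X t ω) ∈ Set.range π} ≠ 0 := by
    by_contra! h
    refine hpos (measure_mono_null ?_ (measure_iUnion_null h))
    rintro ω ⟨t, ht⟩
    obtain ⟨N, hN⟩ := exists_nat_ge t
    exact Set.mem_iUnion.2 ⟨N, t, hN, ht⟩
  let H : Set (ℝ≥0 × E) → Set Ω := fun A => {ω | ∃ t ≤ (N : ℝ≥0), (t, X t ω) ∈ A}
  have hH : Monotone H := fun A A' h ω ⟨t, ht, ht'⟩ => ⟨t, ht, h ht'⟩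
  obtain ⟨c, hc0, hcN⟩ := exists_between (pos_iff_ne_zero.2 hN)
  -- One coordinate at a time can be bounded while the measure stays above the fixed level `c`.
  have step : ∀ (k : ℕ) (S : Set (ℕ → ℕ)), ∃ m : ℕ, c < P (H (π '' S)) →
      c < P (H (π '' (S ∩ {a | a k ≤ m}))) := by
    intro k S
    by_cases hS : c < P (H (π '' S))
    · have hU : H (π '' S) = ⋃ m : ℕ, H (π '' (S ∩ {a | a k ≤ m})) := by
        refine subset_antisymm ?_ (Set.iUnion_subset fun m => hH (Set.image_mono
          Set.inter_subset_left))
        rintro ω ⟨t, ht, a, ha, hat⟩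
        exact Set.mem_iUnion.2 ⟨a k, t, ht, a, ⟨ha, le_refl (a k)⟩, hat⟩
      have hmono : Monotone fun m : ℕ => H (π '' (S ∩ {a | a k ≤ m})) := fun m m' hm =>
        hH (Set.image_mono (Set.inter_subset_inter_right _ fun a ha => le_trans ha hm))
      -- Continuity from below holds for the outer measure, so these events need not be measurable.
      rw [hU, hmono.measure_iUnion, lt_iSup_iff] at hS
      exact hS.imp fun m hm _ => hm
    · exact ⟨0, fun h => absurd h hS⟩
  choose f hf using step
  let S : ℕ → Set (ℕ → ℕ) := fun k => Nat.rec Set.univ (fun k S => S ∩ {a | a k ≤ f k S}) k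
  have hS : ∀ k, c < P (H (π '' S k)) := by
    intro k
    induction k with
    | zero => simpa [S, H, Set.image_univ] using hcN
    | succ k ih => exact hf k (S k) ih
  let n : ℕ → ℕ := fun k => f k (S k)
  have hSn : ∀ k, ∀ a ∈ S k, ∀ i < k, a i ≤ n i := by
    intro k
    induction k with
    | zero => simp
    | succ k ih =>
      rintro a ⟨ha, hak⟩ i hi
      rcases Nat.lt_succ_iff_lt_or_eq.1 hi with h | rfl
      · exact ih a ha i h
      · exact hak
  have hSanti : Antitone S := antitone_nat_of_succ_le fun k => Set.inter_subset_left
  let K : Set (ℕ → ℕ) := Set.univ.pi fun i => Set.Iic (n i)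
  have hK : IsCompact K := isCompact_univ_pi fun i => (Set.finite_Iic _).isCompact
  refine ⟨K, hK, ?_⟩
  -- Continuity from above does need measurable events, hence the closures.
  let D : ℕ → Set Ω := fun k => H (closure (π '' S k))
  have hDm : ∀ k, MeasurableSet (D k) := fun k =>
    measurableSet_hit (fun s _ => hX s) hc isClosed_closure
  have hDanti : Antitone D := fun j k h => hH (closure_mono (Set.image_mono (hSanti h)))
  have hDP : c ≤ P (⋂ k, D k) := by
    rw [hDanti.measure_iInter (fun k => (hDm k).nullMeasurableSet) ⟨0, measure_ne_top _ _⟩]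
    exact le_iInf fun k => (hS k).le.trans (measure_mono (hH subset_closure))
  refine ((hc0.trans_le hDP).trans_le (measure_mono ?_)).ne'
  intro ω hω
  have h1 : ∀ k : ℕ, ∃ (t : ℝ≥0) (a : ℕ → ℕ), t ≤ N ∧ a ∈ S k ∧
      dist (t, X t ω) (π a) < 1 / ((k : ℝ) + 1) := by
    intro k
    obtain ⟨t, ht, htc⟩ := Set.mem_iInter.1 hω k
    obtain ⟨_, ⟨a, ha, rfl⟩, hd⟩ := Metric.mem_closure_iff.1 htc (1 / ((k : ℝ) + 1))
      (by positivity)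
    exact ⟨t, a, ht, ha, hd⟩
  choose t a ht ha hd using h1
  -- Truncation moves `a k` into the compact set `K` and leaves coordinate `i` unchanged once `i <
  -- k`. So a limit of the truncated sequences is also a limit of the original ones.
  let b : ℕ → ℕ → ℕ := fun k i => min (a k i) (n i)
  have hb : ∀ k, b k ∈ K := fun k i _ => Set.mem_Iic.2 (min_le_right (a k i) (n i))
  obtain ⟨⟨s, l⟩, ⟨-, hl⟩, φ, hφ, hlim⟩ := ((isCompact_Icc (a := (0 : ℝ≥0)) (b := N)).prod
    hK).tendsto_subseq (x := fun k => (t k, b k)) fun k => ⟨⟨zero_le, ht k⟩, hb k⟩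
  have hts : Filter.Tendsto (fun k => t (φ k)) Filter.atTop (nhds s) :=
    (continuous_fst.tendsto _).comp hlim
  have hbl : Filter.Tendsto (fun k => b (φ k)) Filter.atTop (nhds l) :=
    (continuous_snd.tendsto _).comp hlim
  have hal : Filter.Tendsto (fun k => a (φ k)) Filter.atTop (nhds l) := by
    rw [tendsto_pi_nhds] at hbl ⊢
    intro i
    refine (hbl i).congr' ?_
    filter_upwards [Filter.eventually_gt_atTop i] with k hk
    exact min_eq_left (hSn _ _ (ha (φ k)) i (hk.trans_le (hφ.id_le k)))
  have h2 : Filter.Tendsto (fun k => (t (φ k), X (t (φ k)) ω)) Filter.atTop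
      (nhds (s, X s ω)) :=
    ((continuous_id.prodMk (hc ω)).tendsto s).comp hts
  have h3 : Filter.Tendsto (fun k => π (a (φ k))) Filter.atTop (nhds (π l)) :=
    (hπ.tendsto l).comp hal
  have h4 : Filter.Tendsto (fun k => dist (t (φ k), X (t (φ k)) ω) (π (a (φ k))))
      Filter.atTop (nhds 0) :=
    squeeze_zero (fun _ => dist_nonneg) (fun k => (hd (φ k)).le)
      (tendsto_one_div_add_atTop_nhds_zero_nat.comp hφ.tendsto_atTop)
  have h5 := tendsto_nhds_unique (h2.dist h3) h4
  exact ⟨s, l, hl, (dist_eq_zero.1 h5).symm⟩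

/-- If, with positive probability, at some time the clock, a continuous adapted process and
some parameter are in the Borel set `G`, then there are a stopping time and a measurable choice
of the parameter that witness this. -/
lemma exists_stopping_selection {mΩ : MeasurableSpace Ω} {P : Measure Ω} [IsFiniteMeasure P]
    [MeasurableSpace E] [BorelSpace E] [PolishSpace E] (F : Filtration ℝ≥0 mΩ)
    (hX : ∀ s, Measurable[F s] (X s)) (hc : ∀ ω, Continuous fun s => X s ω)
    {Z : Type*} [TopologicalSpace Z] [PolishSpace Z] [MeasurableSpace Z] [BorelSpace Z]
    {G : Set ((ℝ≥0 × E) × Z)} (hG : MeasurableSet G)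
    (hpos : P {ω | ∃ t z, ((t, X t ω), z) ∈ G} ≠ 0) :
    ∃ (T : Ω → ℝ≥0∞) (g : ℝ≥0 × E → Z), Measurable g ∧
      (∀ t : ℝ≥0, MeasurableSet[F t] {ω | T ω ≤ t}) ∧ P {ω | T ω ≠ ⊤} ≠ 0 ∧
      ∀ (ω : Ω) (s : ℝ≥0), T ω = s → ((s, X s ω), g (s, X s ω)) ∈ G := by
  -- As an analytic set, `G` is a continuous image of the Baire space. The first component of this
  -- map parametrizes the projection of `G`, and the second provides the witness.
  have hA := hG.analyticSet
  rw [AnalyticSet] at hA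
  rcases hA with rfl | ⟨φ, hφ, rfl⟩
  · simp at hpos
  have hπ : Continuous fun a => (φ a).1 := hφ.fst
  obtain ⟨K, hK, hKpos⟩ := exists_compact_hit (P := P)
    (fun s => (hX s).mono (F.le s) le_rfl) hc hπ (by
      convert hpos using 5 with ω
      refine funext fun t => propext ?_
      constructor
      · rintro ⟨a, ha⟩
        exact ⟨(φ a).2, a, by rw [← ha]⟩
      · rintro ⟨z, a, ha⟩
        exact ⟨a, congrArg Prod.fst ha⟩)
  have hKne : K.Nonempty := by
    by_contra! h
    simp [h] at hKpos
  have : CompactSpace K := isCompact_iff_compactSpace.1 hK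
  have : Nonempty K := hKne.to_subtype
  obtain ⟨g, hg, hgs⟩ := exists_measurable_section_of_compact (K := K)
    (h := fun a => (φ a).1) (hπ.comp continuous_subtype_val)
  set C : Set (ℝ≥0 × E) := (fun a => (φ a).1) '' K with hC
  have hCc : IsClosed C := (hK.image hπ).isClosed
  refine ⟨hitTime X C, fun y => (φ (g y)).2,
    (hφ.snd.measurable.comp measurable_subtype_coe).comp hg, fun t => ?_, ?_, ?_⟩
  · simp only [hitTime_le_iff hc hCc]
    exact @measurableSet_hit _ _ _ _ (F t) _ _ _
      (fun s hs => (hX s).mono (F.mono hs) le_rfl) hc _ hCc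
  · convert hKpos using 4 with ω
    constructor
    · intro h
      obtain ⟨s, hs⟩ := WithTop.ne_top_iff_exists.1 h
      obtain ⟨r, -, hr⟩ := (hitTime_le_iff hc hCc).1 hs.ge
      exact ⟨r, hr⟩
    · intro h
      obtain ⟨s, hs, -⟩ := hitTime_mem hc hCc h
      simp [hs]
  · intro ω s hs
    obtain ⟨r, hr, hrC⟩ := (hitTime_le_iff hc hCc).1 hs.le
    obtain ⟨s', hs', hsC⟩ := hitTime_mem hc hCc ⟨r, hrC⟩
    obtain rfl : s = s' := by rw [hs] at hs'; exact_mod_cast hs'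
    refine ⟨g (s, X s ω), ?_⟩
    refine Prod.ext (hgs _ ?_) rfl
    obtain ⟨a, ha, haC⟩ := hsC
    exact ⟨⟨a, ha⟩, haC⟩

end Hitting

/-! ### Measurability of martingale conditions in the law -/

/-- A σ-algebra that is generated by a measurable map into a countably generated space is
generated by countably many sets; so the vanishing of all integrals of a function over the sets
of this σ-algebra is a measurable condition on the law. -/
lemma measurableSet_forall_setIntegral_eq_zero {Z W : Type*} [MeasurableSpace Z]
    [mW : MeasurableSpace W] [MeasurableSpace.CountablyGenerated W] (κ : Kernel Z W)
    [IsFiniteKernel κ] {σ : W → W} (hσ : Measurable σ) {φ : W → ℝ} (hφ : Measurable φ)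
    (hint : ∀ z, Integrable φ (κ z)) :
    MeasurableSet {z | ∀ A, MeasurableSet[mW.comap σ] A → ∫ w in A, φ w ∂(κ z) = 0} := by
  let C := generateSetAlgebra (MeasurableSpace.countableGeneratingSet W)
  have hC : C.Countable :=
    countable_generateSetAlgebra MeasurableSpace.countable_countableGeneratingSet
  have hgen : mW = MeasurableSpace.generateFrom C := by
    rw [generateFrom_generateSetAlgebra_eq, MeasurableSpace.generateFrom_countableGeneratingSet]
  have hpi : IsPiSystem C := fun s hs t ht _ =>
    (isSetAlgebra_generateSetAlgebra).inter_mem hs ht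
  have hCm : ∀ A ∈ C, MeasurableSet A := fun A hA => by
    rw [hgen]; exact MeasurableSpace.measurableSet_generateFrom hA
  have : {z | ∀ A, MeasurableSet[mW.comap σ] A → ∫ w in A, φ w ∂(κ z) = 0}
      = ⋂ A ∈ C, {z | ∫ w in σ ⁻¹' A, φ w ∂(κ z) = 0} := by
    ext z
    simp only [Set.mem_ofPred_eq, Set.mem_iInter]
    constructor
    · exact fun h A hA => h _ ⟨A, hCm A hA, rfl⟩
    · rintro h _ ⟨A, hA, rfl⟩
      have huniv : ∫ w, φ w ∂(κ z) = 0 := by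
        simpa using h Set.univ (isSetAlgebra_generateSetAlgebra).univ_mem
      induction A, hA using MeasurableSpace.induction_on_inter hgen hpi with
      | empty => simp
      | basic A hA => exact h A hA
      | compl A hA ih =>
        have := integral_add_compl (hσ hA) (hint z)
        rw [ih, zero_add, huniv] at this
        exact this
      | iUnion f hd hf ih =>
        rw [Set.preimage_iUnion, integral_iUnion (fun i => hσ (hf i))
          (fun i j hij => (hd hij).preimage σ) (hint z).integrableOn]
        simp [ih]
  rw [this]
  refine .biInter hC fun A hA => ?_
  have h1 : ∀ z, ∫ w in σ ⁻¹' A, φ w ∂(κ z) = ∫ w, (σ ⁻¹' A).indicator φ w ∂(κ z) :=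
    fun z => (integral_indicator (hσ (hCm A hA))).symm
  simp only [h1]
  exact ((hφ.indicator (hσ (hCm A hA))).stronglyMeasurable.integral_kernel
    (κ := κ)).measurable (measurableSet_singleton 0)

/-! ### The filtration of a process that is continued by an independent choice of path -/

section Glue

variable {ι Ω W : Type*} [Preorder ι] {mΩ : MeasurableSpace Ω} {mW : MeasurableSpace W}

/-- The filtration on `Ω × W` that knows the first component up to a random time, and then also
the second component, from its beginning: at time `s`, the second component is active on the set
`active s`, and then it is known up to time `age s`. -/
def gluedFiltration (F : Filtration ι mΩ) (G : Filtration ι mW) (active : ι → Set Ω)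
    (age : ι → Ω → ι) (hactive : Monotone active) (hage : ∀ ω, Monotone fun s => age s ω) :
    Filtration ι (mΩ.prod mW) where
  seq s :=
    { MeasurableSet' := fun A => MeasurableSet[mΩ.prod mW] A ∧
        (∀ ω ∈ active s, MeasurableSet[G (age s ω)] (Prod.mk ω ⁻¹' A)) ∧
        ∃ A₁, MeasurableSet[F s] A₁ ∧ ∀ ω ∉ active s, ∀ w, (ω, w) ∈ A ↔ ω ∈ A₁
      measurableSet_empty :=
        ⟨MeasurableSet.empty, fun ω _ => @MeasurableSet.empty _ (G (age s ω)), ∅,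
        @MeasurableSet.empty _ (F s), by simp⟩
      measurableSet_compl := by
        rintro A ⟨hA, hA', A₁, hA₁, h⟩
        exact ⟨hA.compl, fun ω hω => (hA' ω hω).compl, A₁ᶜ, hA₁.compl,
          fun ω hω w => not_congr (h ω hω w)⟩
      measurableSet_iUnion := by
        intro f hf
        choose hf hf' f₁ hf₁ h using hf
        refine ⟨MeasurableSet.iUnion hf, fun ω hω => ?_, ⋃ i, f₁ i, MeasurableSet.iUnion hf₁,
          fun ω hω w => ?_⟩
        · rw [Set.preimage_iUnion]
          exact MeasurableSet.iUnion fun i => hf' i ω hω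
        · simp only [Set.mem_iUnion, h _ ω hω w] }
  mono' := by
    rintro s t hst A ⟨hA, hA', A₁, hA₁, h⟩
    refine ⟨hA, fun ω hω => ?_, A₁, F.mono hst _ hA₁, fun ω hω w =>
      h ω (fun h' => hω (hactive hst h')) w⟩
    -- A fibre that is not yet active at `s` meets `A` in everything or nothing, which is measurable
    -- at every age.
    by_cases hs : ω ∈ active s
    · exact G.mono (hage ω hst) _ (hA' ω hs)
    · by_cases hω₁ : ω ∈ A₁
      · convert MeasurableSet.univ
        ext w
        simp [h ω hs w, hω₁]
      · convert MeasurableSet.empty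
        ext w
        simp [h ω hs w, hω₁]
  le' := fun s A hA => hA.1

variable {F : Filtration ι mΩ} {G : Filtration ι mW} {active : ι → Set Ω}
  {age : ι → Ω → ι} {hactive : Monotone active} {hage : ∀ ω, Monotone fun s => age s ω}

lemma measurable_gluedFiltration {β : Type*} [MeasurableSpace β] {s : ι} {f : Ω × W → β}
    (hf : Measurable f) (hsec : ∀ ω ∈ active s, Measurable[G (age s ω)] fun w => f (ω, w))
    {f₁ : Ω → β} (hf₁ : Measurable[F s] f₁) (h : ∀ ω ∉ active s, ∀ w, f (ω, w) = f₁ ω) :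
    Measurable[gluedFiltration F G active age hactive hage s] f := by
  intro A hA
  refine ⟨hf hA, fun ω hω => hsec ω hω hA, f₁ ⁻¹' A, hf₁ hA, fun ω hω w => ?_⟩
  simp [h ω hω w]

end Glue

/-! ### Kernels -/

/-- Finite measures are determined by their values on a countable algebra that generates, so
equality amounts to countably many measurable conditions. -/
lemma measurableSet_kernel_eq {Z Y : Type*} [MeasurableSpace Z] [mY : MeasurableSpace Y]
    [MeasurableSpace.CountablyGenerated Y] (κ η : Kernel Z Y) [IsFiniteKernel κ]
    [IsFiniteKernel η] : MeasurableSet {z | κ z = η z} := by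
  let C := generateSetAlgebra (MeasurableSpace.countableGeneratingSet Y)
  have hC : C.Countable :=
    countable_generateSetAlgebra MeasurableSpace.countable_countableGeneratingSet
  have hgen : mY = MeasurableSpace.generateFrom C := by
    rw [generateFrom_generateSetAlgebra_eq, MeasurableSpace.generateFrom_countableGeneratingSet]
  have hpi : IsPiSystem C := fun s hs t ht _ =>
    (isSetAlgebra_generateSetAlgebra).inter_mem hs ht
  have : {z | κ z = η z} = ⋂ A ∈ C, {z | κ z A = η z A} := by
    ext z
    simp only [Set.mem_ofPred_eq, Set.mem_iInter]
    refine ⟨fun h A _ => by rw [h], fun h => ?_⟩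
    exact ext_of_generate_finite C hgen hpi h (h _ (isSetAlgebra_generateSetAlgebra).univ_mem)
  rw [this]
  refine .biInter hC fun A hA => ?_
  have hA : MeasurableSet A := by
    rw [hgen]; exact MeasurableSpace.measurableSet_generateFrom hA
  exact measurableSet_eq_fun (κ.measurable_coe hA) (η.measurable_coe hA)

/-- Turns a selected parameter into a kernel of continuations. The Dirac mass off `H` only serves to
make it Markov everywhere. -/
lemma exists_markovKernel_eqOn {Ω Z W : Type*} [MeasurableSpace Ω] [MeasurableSpace Z]
    [MeasurableSpace W] [Nonempty W] (κ : Kernel Z W) {H : Set Ω} (hH : MeasurableSet H)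
    {g : Ω → Z} (hg : Measurable g) (hκ : ∀ ω ∈ H, IsProbabilityMeasure (κ (g ω))) :
    ∃ η : Kernel Ω W, IsMarkovKernel η ∧ ∀ ω ∈ H, η ω = κ (g ω) := by
  classical
  obtain ⟨w₀⟩ := ‹Nonempty W›
  refine ⟨Kernel.piecewise hH (κ.comap g hg) (Kernel.const Ω (Measure.dirac w₀)), ⟨fun ω => ?_⟩,
    fun ω hω => ?_⟩
  · rw [Kernel.piecewise_apply]
    split_ifs with hω
    · exact hκ ω hω
    · rw [Kernel.const_apply]
      infer_instance
  · rw [Kernel.piecewise_apply, if_pos hω, Kernel.comap_apply]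

/-- A null set of the composition is null on almost every fibre. In this form neither `H` nor `O`
has to be measurable. -/
lemma compProd_ne_zero {Ω W : Type*} [MeasurableSpace Ω] [MeasurableSpace W] {P : Measure Ω}
    [SFinite P] {η : Kernel Ω W} [IsSFiniteKernel η] {H : Set Ω} (hH : P H ≠ 0)
    {O : Set (Ω × W)} (hO : ∀ ω ∈ H, η ω (Prod.mk ω ⁻¹' O) ≠ 0) : (P ⊗ₘ η) O ≠ 0 := by
  intro h
  have h1 : ∀ᵐ p ∂(P ⊗ₘ η), p ∉ O := measure_eq_zero_iff_ae_notMem.1 h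
  have h2 := Measure.ae_ae_of_ae_compProd h1
  refine hH (measure_mono_null (fun ω hω => ?_) h2)
  intro h3
  exact hO ω hω (measure_eq_zero_iff_ae_notMem.2 h3)

/-- A conditional probability is given by a kernel if it is so in integrated form. -/
lemma condExp_indicator_eq_kernel_iff {Ω E Y : Type*} {m mΩ : MeasurableSpace Ω}
    [MeasurableSpace E] [MeasurableSpace Y] {P : Measure Ω} [IsProbabilityMeasure P]
    (hm : m ≤ mΩ) {X : Ω → E} (hX : Measurable X) (K : Kernel Y E) [IsMarkovKernel K] {V : Ω → Y}
    (hV : Measurable[m] V) {C : Set E} (hC : MeasurableSet C) :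
    P[(X ⁻¹' C).indicator (fun _ => (1 : ℝ)) | m] =ᵐ[P] (fun ω => (K (V ω)).real C) ↔
      ∀ A, MeasurableSet[m] A → P (A ∩ X ⁻¹' C) = ∫⁻ ω in A, K (V ω) C ∂P := by
  have hint : Integrable ((X ⁻¹' C).indicator (fun _ => (1 : ℝ))) P :=
    (integrable_const 1).indicator (hX hC)
  have hKm : Measurable[m] fun ω => K (V ω) C := (K.measurable_coe hC).comp hV
  have hKint : Integrable (fun ω => (K (V ω)).real C) P :=
    Integrable.of_bound (hKm.mono hm le_rfl).ennreal_toReal.aestronglyMeasurable 1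
      (Filter.Eventually.of_forall fun ω => by
        rw [Real.norm_of_nonneg measureReal_nonneg]; exact measureReal_le_one)
  have hind : ∀ A, MeasurableSet[m] A →
      ∫ ω in A, (X ⁻¹' C).indicator (fun _ => (1 : ℝ)) ω ∂P = (P (A ∩ X ⁻¹' C)).toReal := by
    intro A hA
    rw [setIntegral_indicator (hX hC), setIntegral_const]
    simp [measureReal_def]
  have hker : ∀ A, ∫ ω in A, (K (V ω)).real C ∂P = (∫⁻ ω in A, K (V ω) C ∂P).toReal := by
    intro A
    exact integral_toReal (hKm.mono hm le_rfl).aemeasurable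
      (Filter.Eventually.of_forall fun ω => measure_lt_top _ _)
  have hfin : ∀ A, ∫⁻ ω in A, K (V ω) C ∂P ≠ ⊤ := by
    intro A
    refine ((lintegral_mono fun ω => prob_le_one).trans_lt ?_).ne
    simp
  constructor
  · intro h A hA
    have h1 := setIntegral_condExp hm hint hA
    rw [setIntegral_congr_ae (g := fun ω => (K (V ω)).real C) (hm A hA)
      (h.mono fun ω hω _ => hω), hind A hA, hker A] at h1
    exact ((ENNReal.toReal_eq_toReal_iff' (hfin A) (measure_ne_top _ _)).1 h1).symm
  · intro h
    refine (ae_eq_condExp_of_forall_setIntegral_eq hm hint (fun A _ _ => hKint.integrableOn)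
      (fun A hA _ => ?_) hKm.ennreal_toReal.aestronglyMeasurable).symm
    rw [hind A hA, hker A, h A hA]

/-! ### Discrete time -/

namespace DiscreteMDP

variable {E A : Type} [MeasurableSpace E] [MeasurableSpace A]

/-- The transition kernel with absorption in the terminal states. -/
noncomputable def stepKernel (M : DiscreteMDP E A) : Kernel (E × A) E :=
  open Classical in
  Kernel.piecewise (measurable_fst M.measurableSet_terminal)
    (Kernel.deterministic Prod.fst measurable_fst) M.transition

lemma stepKernel_apply (M : DiscreteMDP E A) (p : E × A) : M.stepKernel p = M.step p.1 p.2 := by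
  classical
  rw [stepKernel, Kernel.piecewise_apply, step]
  by_cases h : p.1 ∈ M.terminal
  · rw [if_pos h, if_pos (show p ∈ Prod.fst ⁻¹' M.terminal from h), Kernel.deterministic_apply]
  · rw [if_neg h, if_neg (show p ∉ Prod.fst ⁻¹' M.terminal from h)]

instance (M : DiscreteMDP E A) : IsMarkovKernel M.stepKernel := by
  classical
  have := M.isMarkovKernel_transition
  unfold stepKernel
  infer_instance

/-- The sequence stopped at time `k`. -/
def stopSeq {Y : Type} (k : ℕ) (w : ℕ → Y) : ℕ → Y := fun j => w (min j k)

lemma measurable_stopSeq {Y : Type} [MeasurableSpace Y] (k : ℕ) :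
    Measurable (stopSeq k : (ℕ → Y) → ℕ → Y) :=
  measurable_pi_lambda _ fun _ => measurable_pi_apply _

/-- The canonical filtration on sequences. -/
def seqFiltration (Y : Type) [MeasurableSpace Y] :
    Filtration ℕ (MeasurableSpace.pi : MeasurableSpace (ℕ → Y)) where
  seq k := MeasurableSpace.comap (stopSeq k) MeasurableSpace.pi
  mono' := by
    rintro j k hjk _ ⟨C, hC, rfl⟩
    refine ⟨stopSeq j ⁻¹' C, measurable_stopSeq j hC, ?_⟩
    ext w
    have : stopSeq j (stopSeq k w) = stopSeq j w := by
      ext i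
      simp [stopSeq, min_assoc, min_eq_left hjk]
    simp [this]
  le' k := (measurable_stopSeq k).comap_le

lemma measurable_seqFiltration_eval {Y : Type} [MeasurableSpace Y] (k : ℕ) :
    Measurable[seqFiltration Y k] fun w : ℕ → Y => w k := by
  have h1 : (fun w : ℕ → Y => w k) = (fun w : ℕ → Y => w k) ∘ stopSeq k := by
    ext w
    simp [stopSeq]
  rw [h1]
  exact (measurable_pi_apply k).comp (comap_measurable _)

lemma measurable_seq_of_adapted {Y Ω : Type} [MeasurableSpace Y] {mΩ : MeasurableSpace Ω}
    (F : Filtration ℕ mΩ) {f : Ω → ℕ → Y} (hf : ∀ k, Measurable[F k] fun ω => f ω k) (k : ℕ) :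
    Measurable[F k, seqFiltration Y k] f := by
  rintro _ ⟨C, hC, rfl⟩
  have h : Measurable[F k] fun ω => stopSeq k (f ω) := by
    refine @measurable_pi_lambda _ _ _ (F k) _ _ fun j => ?_
    exact (hf (min j k)).mono (F.mono (min_le_right _ _)) le_rfl
  exact h hC

/-- `Q` is the law of the sequence of states and actions of a future course from `x`. -/
structure IsLaw (M : DiscreteMDP E A) (x : E) (Q : Measure (ℕ → E × A)) : Prop where
  isProbabilityMeasure : IsProbabilityMeasure Q
  initial : ∀ᵐ w ∂Q, (w 0).1 = x
  transition : ∀ k C D, MeasurableSet C → MeasurableSet D →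
    Q (stopSeq k ⁻¹' D ∩ {w | (w (k + 1)).1 ∈ C}) =
      ∫⁻ w in stopSeq k ⁻¹' D, M.stepKernel (w k) C ∂Q

/-- The set of sequences for which the state is in `B` at some time before or at `h`. -/
def occursSeq (A : Type) (B : Set E) (h : ℕ∞) : Set (ℕ → E × A) :=
  {w | ∃ k : ℕ, (k : ℕ∞) ≤ h ∧ (w k).1 ∈ B}

lemma measurableSet_occursSeq {B : Set E} (hB : MeasurableSet B) (h : ℕ∞) :
    MeasurableSet (occursSeq A B h) := by
  have : occursSeq A B h = ⋃ (k : ℕ) (_ : (k : ℕ∞) ≤ h), {w | (w k).1 ∈ B} := by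
    ext w
    simp [occursSeq]
  rw [this]
  exact .iUnion fun k => .iUnion fun _ => (measurable_pi_apply k).fst hB

/-- The integrated transition property tests only events of the canonical filtration. Their
preimages are known to the filtration of the course, so the property passes to the law. -/
lemma Course.isLaw {M : DiscreteMDP E A} {x : E} {Ω : Type} [MeasurableSpace Ω] {P : Measure Ω}
    [MeasurableSingletonClass E] (S : M.Course x P) :
    M.IsLaw x (P.map fun ω k => (S.X k ω, S.u k ω)) := by
  have := S.isProbabilityMeasure
  have hV : ∀ k, Measurable[S.filtration k] fun ω => (S.X k ω, S.u k ω) :=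
    fun k => (S.adapted_X k).prodMk (S.adapted_u k)
  have hf : Measurable fun ω k => (S.X k ω, S.u k ω) :=
    measurable_pi_lambda _ fun k => (hV k).mono (S.filtration.le k) le_rfl
  refine ⟨Measure.isProbabilityMeasure_map hf.aemeasurable, ?_, fun k C D hC hD => ?_⟩
  · have hs : MeasurableSet {w : ℕ → E × A | (w 0).1 = x} :=
      (measurable_pi_apply 0).fst (measurableSet_singleton x)
    rw [ae_map_iff hf.aemeasurable hs]
    exact S.initial
  · have h1 := (condExp_indicator_eq_kernel_iff (S.filtration.le k)
      ((S.adapted_X (k + 1)).mono (S.filtration.le _) le_rfl) M.stepKernel (hV k) hC).1 (by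
        simpa only [stepKernel_apply] using S.transition k C hC)
    have hD' : MeasurableSet (stopSeq (Y := E × A) k ⁻¹' D) := measurable_stopSeq k hD
    have hC' : MeasurableSet {w : ℕ → E × A | (w (k + 1)).1 ∈ C} :=
      (measurable_pi_apply (k + 1)).fst hC
    have hK : Measurable fun w : ℕ → E × A => M.stepKernel (w k) C :=
      (M.stepKernel.measurable_coe hC).comp (measurable_pi_apply k)
    rw [Measure.map_apply hf (hD'.inter hC'), setLIntegral_map hD' hK hf]
    exact h1 _ (measurable_seq_of_adapted S.filtration hV k ⟨D, hD, rfl⟩)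

lemma IsLaw.transition_eq {M : DiscreteMDP E A} {x : E} {Q : Measure (ℕ → E × A)}
    (hQ : M.IsLaw x Q) {k : ℕ} {D : Set (ℕ → E × A)} (hD : MeasurableSet[seqFiltration _ k] D)
    {C : Set E} (hC : MeasurableSet C) :
    Q (D ∩ {w | (w (k + 1)).1 ∈ C}) = ∫⁻ w in D, M.stepKernel (w k) C ∂Q := by
  obtain ⟨D, hD, rfl⟩ := hD
  exact hQ.transition k C D hC hD

section StandardBorel

variable [StandardBorelSpace E]

/-- The transition property at time `k` says that the joint law of the stopped sequence and the next
state is a composition product. It is thus an equality of two kernels, tested on rectangles. -/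
lemma measurableSet_isLaw [StandardBorelSpace A] (M : DiscreteMDP E A) {Z : Type*}
    [MeasurableSpace Z] (κ : Kernel Z (ℕ → E × A)) [IsFiniteKernel κ] :
    MeasurableSet {p : E × Z | M.IsLaw p.1 (κ p.2)} := by
  have h1 : MeasurableSet {z | κ z Set.univ = 1} :=
    κ.measurable_coe .univ (measurableSet_singleton 1)
  have h2 : MeasurableSet {p : E × Z | κ p.2 {w | (w 0).1 ≠ p.1} = 0} := by
    have hs : MeasurableSet {q : (E × Z) × (ℕ → E × A) | (q.2 0).1 ≠ q.1.1} :=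
      (measurableSet_eq_fun ((measurable_pi_apply 0).comp measurable_snd).fst
        measurable_fst.fst).compl
    exact (Kernel.measurable_kernel_prodMk_left (κ := κ.comap Prod.snd measurable_snd) hs)
      (measurableSet_singleton 0)
  have h3 : ∀ k, MeasurableSet {z | ∀ C D, MeasurableSet C → MeasurableSet D →
      κ z (stopSeq k ⁻¹' D ∩ {w | (w (k + 1)).1 ∈ C}) =
        ∫⁻ w in stopSeq k ⁻¹' D, M.stepKernel (w k) C ∂(κ z)} := by
    intro k
    have hf : Measurable fun w : ℕ → E × A => (stopSeq k w, (w (k + 1)).1) :=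
      (measurable_stopSeq k).prodMk (measurable_pi_apply (k + 1)).fst
    let η₁ : Kernel Z ((ℕ → E × A) × E) := κ.map fun w => (stopSeq k w, (w (k + 1)).1)
    let η₂ : Kernel Z ((ℕ → E × A) × E) := (κ.map (stopSeq k)) ⊗ₖ
      (Kernel.prodMkLeft Z (M.stepKernel.comap (fun w : ℕ → E × A => w k)
        (measurable_pi_apply k)))
    have : IsFiniteKernel η₁ := Kernel.IsFiniteKernel.map _ _
    have : IsFiniteKernel (κ.map (stopSeq k)) := Kernel.IsFiniteKernel.map _ _
    convert measurableSet_kernel_eq η₁ η₂ using 3 with z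
    have e1 : ∀ C D, MeasurableSet C → MeasurableSet D → η₁ z (D ×ˢ C) =
        κ z (stopSeq k ⁻¹' D ∩ {w | (w (k + 1)).1 ∈ C}) := by
      intro C D hC hD
      rw [Kernel.map_apply' _ hf _ (hD.prod hC)]
      rfl
    have e2 : ∀ C D, MeasurableSet C → MeasurableSet D → η₂ z (D ×ˢ C) =
        ∫⁻ w in stopSeq k ⁻¹' D, M.stepKernel (w k) C ∂(κ z) := by
      intro C D hC hD
      rw [Kernel.compProd_apply_prod hD hC, Kernel.map_apply _ (measurable_stopSeq k),
        setLIntegral_map hD _ (measurable_stopSeq k)]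
      · simp [Kernel.prodMkLeft_apply, Kernel.comap_apply, stopSeq]
      · simp only [Kernel.prodMkLeft_apply, Kernel.comap_apply]
        exact (M.stepKernel.measurable_coe hC).comp (measurable_pi_apply k)
    constructor
    · intro h
      refine Measure.ext_prod fun {D C} hD hC => ?_
      rw [e1 C D hC hD, e2 C D hC hD, h C D hC hD]
    · intro h C D hC hD
      rw [← e1 C D hC hD, ← e2 C D hC hD, h]
  convert (measurable_snd h1).inter (h2.inter (measurable_snd (MeasurableSet.iInter h3)))
    using 1
  ext ⟨x, z⟩
  simp only [Set.mem_ofPred_eq, Set.mem_inter_iff, Set.mem_preimage, Set.mem_iInter]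
  exact ⟨fun h => ⟨h.1.1, h.2, h.3⟩, fun h => ⟨⟨h.1⟩, h.2.1, h.2.2⟩⟩

/-- A future course can be continued, from time `k` on and on an event `H` that is known by then,
by future courses from the state at time `k`. -/
lemma Course.exists_glue {M : DiscreteMDP E A} {x : E} {Ω : Type} [mΩ : MeasurableSpace Ω]
    {P : Measure Ω} (S : M.Course x P) (k : ℕ) {H : Set Ω}
    (hH : MeasurableSet[S.filtration k] H) (η : Kernel Ω (ℕ → E × A)) [IsMarkovKernel η]
    (hη : ∀ ω ∈ H, M.IsLaw (S.X k ω) (η ω)) :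
    ∃ S' : M.Course x (P ⊗ₘ η), ∀ ω ∈ H, ∀ w j, S'.X (k + j) (ω, w) = (w j).1 := by
  classical
  have := S.isProbabilityMeasure
  let active : ℕ → Set Ω := fun j => {ω | k ≤ j ∧ ω ∈ H}
  have hactive : Monotone active := fun i j hij ω hω => ⟨hω.1.trans hij, hω.2⟩
  have hage : ∀ _ : Ω, Monotone fun j => j - k := fun _ i j hij => Nat.sub_le_sub_right hij k
  have hact : ∀ j, MeasurableSet[S.filtration j] (active j) := by
    intro j
    by_cases h : k ≤ j
    · have : active j = H := by ext ω; simp [active, h]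
      rw [this]
      exact S.filtration.mono h _ hH
    · have : active j = ∅ := by ext ω; simp [active, h]
      rw [this]
      exact @MeasurableSet.empty _ (S.filtration j)
  let G := gluedFiltration S.filtration (seqFiltration (E × A)) active (fun j _ => j - k)
    hactive hage
  let V : ℕ → Ω → E × A := fun j ω => (S.X j ω, S.u j ω)
  have hV : ∀ j, Measurable[S.filtration j] (V j) :=
    fun j => (S.adapted_X j).prodMk (S.adapted_u j)
  have hV' : ∀ j, Measurable (V j) := fun j => (hV j).mono (S.filtration.le j) le_rfl
  let Y : ℕ → Ω × (ℕ → E × A) → E × A := fun j p =>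
    if p.1 ∈ active j then p.2 (j - k) else V j p.1
  have hYact : ∀ j, ∀ ω ∈ active j, ∀ w, Y j (ω, w) = w (j - k) := fun j ω hω w => if_pos hω
  have hYnot : ∀ j, ∀ ω ∉ active j, ∀ w, Y j (ω, w) = V j ω := fun j ω hω w => if_neg hω
  have hYm : ∀ j, Measurable (Y j) := fun j => Measurable.ite
    (measurable_fst (S.filtration.le j _ (hact j)))
    ((measurable_pi_apply _).comp measurable_snd) ((hV' j).comp measurable_fst)
  have hY : ∀ j, Measurable[G j] (Y j) := by
    intro j
    refine measurable_gluedFiltration (hYm j) (fun ω hω => ?_) (hV j) (hYnot j)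
    simp only [hYact j ω hω]
    exact measurable_seqFiltration_eval _
  refine ⟨{ isProbabilityMeasure := inferInstance
            filtration := G
            u := fun j p => (Y j p).2
            X := fun j p => (Y j p).1
            adapted_u := fun j => (hY j).snd
            adapted_X := fun j => (hY j).fst
            initial := ?_
            transition := fun j C hC => ?_ }, fun ω hω w j => ?_⟩
  · refine Measure.ae_compProd_of_ae_ae ((hYm 0).fst (measurableSet_singleton x)) ?_
    filter_upwards [S.initial] with ω hω
    by_cases h : ω ∈ active 0
    · filter_upwards [(hη ω h.2).initial] with w hw
      have hk : k = 0 := Nat.le_zero.1 h.1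
      rw [hYact 0 ω h, Nat.zero_sub, hw, hk, hω]
    · refine Filter.Eventually.of_forall fun w => ?_
      rw [hYnot 0 ω h]
      exact hω
  · have key := (condExp_indicator_eq_kernel_iff (P := P ⊗ₘ η) (G.le j) (hYm (j + 1)).fst
      M.stepKernel (hY j) hC).2
    simp only [stepKernel_apply] at key
    refine key fun D hD => ?_
    simp only [← stepKernel_apply]
    obtain ⟨hDm, hDsec, D₁, hD₁, hDD₁⟩ := hD
    have hKm : Measurable fun p => M.stepKernel (Y j p) C :=
      (M.stepKernel.measurable_coe hC).comp (hYm j)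
    have hact' := S.filtration.le j _ (hact j)
    -- On fibres that are active at time `j`, the law `η ω` provides the transition; on the others
    -- the course `S` does.
    rw [Measure.compProd_apply (hDm.inter ((hYm (j + 1)).fst hC)),
      ← lintegral_indicator hDm, Measure.lintegral_compProd (hKm.indicator hDm),
      ← lintegral_add_compl _ hact', ← lintegral_add_compl (fun ω => ∫⁻ w, _ ∂(η ω)) hact']
    congr 1
    · refine setLIntegral_congr_fun hact' fun ω hω => ?_
      have hω' : ω ∈ active (j + 1) := hactive (Nat.le_succ j) hω
      have e1 : (fun w => D.indicator (fun p => M.stepKernel (Y j p) C) (ω, w)) =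
          (Prod.mk ω ⁻¹' D).indicator fun w => M.stepKernel (w (j - k)) C := by
        ext w
        by_cases hw : (ω, w) ∈ D
        · rw [Set.indicator_of_mem hw, Set.indicator_of_mem (show w ∈ Prod.mk ω ⁻¹' D from hw),
            hYact j ω hω]
        · rw [Set.indicator_of_notMem hw,
            Set.indicator_of_notMem (show w ∉ Prod.mk ω ⁻¹' D from hw)]
      simp only [e1]
      rw [lintegral_indicator (measurable_prodMk_left hDm),
        ← (hη ω hω.2).transition_eq (hDsec ω hω) hC]
      congr 1
      ext w
      simp only [Set.mem_preimage, Set.mem_inter_iff, hYact (j + 1) ω hω', Set.mem_ofPred_eq,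
        Nat.sub_add_comm hω.1]
    · have e1 : ∀ ω ∈ (active j)ᶜ, η ω (Prod.mk ω ⁻¹' (D ∩ (fun p => (Y (j + 1) p).1) ⁻¹' C)) =
          (D₁ ∩ S.X (j + 1) ⁻¹' C).indicator 1 ω := by
        intro ω hω
        have e2 : ∀ᵐ w ∂(η ω), (ω, w) ∈ D ∩ (fun p => (Y (j + 1) p).1) ⁻¹' C ↔
            ω ∈ D₁ ∩ S.X (j + 1) ⁻¹' C := by
          -- The continuation may begin exactly at `k = j + 1`. Its first state is then almost
          -- surely `S.X k`, so the transition into time `j + 1` is still that of `S`.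
          by_cases h : ω ∈ active (j + 1)
          · have hk : k = j + 1 := by
              refine le_antisymm h.1 ?_
              by_contra hlt
              exact hω ⟨by omega, h.2⟩
            filter_upwards [(hη ω h.2).initial] with w hw
            simp only [Set.mem_inter_iff, Set.mem_preimage, hYact _ ω h, hDD₁ ω hω w]
            rw [hk, Nat.sub_self]
            rw [hw, hk]
          · refine Filter.Eventually.of_forall fun w => ?_
            simp only [Set.mem_inter_iff, Set.mem_preimage, hYnot _ ω h, hDD₁ ω hω w, V]
        by_cases h : ω ∈ D₁ ∩ S.X (j + 1) ⁻¹' C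
        · rw [Set.indicator_of_mem h, Pi.one_apply]
          refine (measure_congr ?_).trans (measure_univ (μ := η ω))
          filter_upwards [e2] with w hw
          exact propext ⟨fun _ => trivial, fun _ => hw.2 h⟩
        · rw [Set.indicator_of_notMem h, measure_eq_zero_iff_ae_notMem]
          filter_upwards [e2] with w hw hw'
          exact h (hw.1 hw')
      have e3 : ∀ ω ∈ (active j)ᶜ, ∫⁻ w, D.indicator (fun p => M.stepKernel (Y j p) C) (ω, w)
          ∂(η ω) = D₁.indicator (fun ω => M.stepKernel (V j ω) C) ω := by
        intro ω hω
        have e4 : ∀ w, D.indicator (fun p => M.stepKernel (Y j p) C) (ω, w) =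
            D₁.indicator (fun ω => M.stepKernel (V j ω) C) ω := by
          intro w
          by_cases h : ω ∈ D₁
          · rw [Set.indicator_of_mem h, Set.indicator_of_mem ((hDD₁ ω hω w).2 h), hYnot j ω hω]
          · rw [Set.indicator_of_notMem h,
              Set.indicator_of_notMem (fun h' => h ((hDD₁ ω hω w).1 h'))]
        simp [e4]
      have hX1 : MeasurableSet (S.X (j + 1) ⁻¹' C) := (hV' (j + 1)).fst hC
      have hD₁' := S.filtration.le j _ hD₁
      rw [setLIntegral_congr_fun hact'.compl e1, setLIntegral_congr_fun hact'.compl e3,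
        setLIntegral_indicator hD₁', lintegral_indicator_one (hD₁'.inter hX1),
        Measure.restrict_apply (hD₁'.inter hX1)]
      have h1 := (condExp_indicator_eq_kernel_iff (S.filtration.le j)
        ((S.adapted_X (j + 1)).mono (S.filtration.le _) le_rfl) M.stepKernel (hV j) hC).1 (by
          simpa only [stepKernel_apply] using S.transition j C hC) (D₁ ∩ (active j)ᶜ)
          (hD₁.inter (hact j).compl)
      rw [← h1, Set.inter_right_comm]
  · have : ω ∈ active (k + j) := ⟨Nat.le_add_right k j, hω⟩
    simp [hYact _ ω this]

/-- There are countably many times, so a failure has positive outer measure at one fixed `k`. There,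
the course is continued on the event that a witness has been selected. -/
theorem reachability_remains_zero [StandardBorelSpace A] (M : DiscreteMDP E A) {B : Set E}
    (hB : MeasurableSet B) {h : ℕ∞} {x : E} (hx : M.reachability B h x = 0) {Ω : Type} [mΩ : MeasurableSpace Ω]
    {P : Measure Ω} (S : M.Course x P) :
    ∀ᵐ ω ∂P, ∀ k : ℕ, (k : ℕ∞) ≤ h → M.reachability B (h - k) (S.X k ω) = 0 := by
  have := S.isProbabilityMeasure
  rw [ae_all_iff]
  intro k
  by_cases hk : (k : ℕ∞) ≤ h
  swap
  · exact Filter.Eventually.of_forall fun ω h' => absurd h' hk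
  simp only [hk, true_imp_iff]
  by_contra hcon
  obtain ⟨κ, hκ, hκs⟩ := exists_kernel_attaining (ℕ → E × A)
  let := upgradeStandardBorel E
  let := TopologicalSpace.upgradeIsCompletelyMetrizable E
  let G : Set ((ℝ≥0 × E) × (ℚ → ℝ)) :=
    {p | M.IsLaw p.1.2 (κ p.2) ∧ κ p.2 (occursSeq A B (h - k)) ≠ 0}
  have hG : MeasurableSet G := by
    refine MeasurableSet.inter
      ((measurable_fst.snd.prodMk measurable_snd) (M.measurableSet_isLaw κ)) ?_
    exact (((κ.measurable_coe (measurableSet_occursSeq hB _)).comp measurable_snd)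
      (measurableSet_singleton 0)).compl
  -- With `k` fixed, the selection is applied to a constant process and a constant filtration. The
  -- clock is a dummy, and finiteness of `T` is an event known at time `k`.
  let F : Filtration ℝ≥0 mΩ := ⟨fun _ => S.filtration k, monotone_const,
    fun _ => S.filtration.le k⟩
  obtain ⟨T, g, hg, hT, hTpos, hgG⟩ := exists_stopping_selection (P := P) F
    (X := fun _ => S.X k) (fun _ => S.adapted_X k) (fun _ => continuous_const) hG (by
      refine fun h0 => hcon (measure_mono_null ?_ h0)
      intro ω hω
      have hne : M.reachability B (h - k) (S.X k ω) ≠ 0 := hω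
      simp only [reachability, ne_eq, ENNReal.iSup_eq_zero, not_forall] at hne
      obtain ⟨Ω', mΩ', P', S', hS'⟩ := hne
      obtain ⟨z, hz⟩ := hκs _ S'.isLaw.isProbabilityMeasure
      refine ⟨0, z, ?_, ?_⟩
      · simp only [hz]
        exact S'.isLaw
      · simp only [hz]
        rw [Measure.map_apply _ (measurableSet_occursSeq hB _)]
        · exact hS'
        · exact measurable_pi_lambda _ fun j => ((S'.adapted_X j).mono
            (S'.filtration.le j) le_rfl).prodMk ((S'.adapted_u j).mono (S'.filtration.le j) le_rfl))
  let H : Set Ω := {ω | T ω ≠ ⊤}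
  have hH : MeasurableSet[S.filtration k] H := by
    have : H = ⋃ n : ℕ, {ω | T ω ≤ ((n : ℝ≥0) : ℝ≥0∞)} := by
      ext ω
      simp only [H, Set.mem_ofPred_eq, Set.mem_iUnion]
      constructor
      · intro hω
        obtain ⟨s, hs⟩ := WithTop.ne_top_iff_exists.1 hω
        obtain ⟨n, hn⟩ := exists_nat_ge s
        exact ⟨n, by rw [← hs]; exact ENNReal.coe_le_coe.2 hn⟩
      · rintro ⟨n, hn⟩ htop
        simp [htop] at hn
    rw [this]
    exact @MeasurableSet.iUnion _ _ (S.filtration k) _ _ fun n => hT n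
  have hT' : Measurable T := measurable_of_measurableSet_le F hT
  have hGω : ∀ ω ∈ H, (((T ω).toNNReal, S.X k ω), g ((T ω).toNNReal, S.X k ω)) ∈ G :=
    fun ω hω => hgG ω _ (ENNReal.coe_toNNReal hω).symm
  have hne : Nonempty (ℕ → E × A) := by
    have : Nonempty Ω := nonempty_of_isProbabilityMeasure P
    obtain ⟨ω⟩ := this
    exact ⟨fun j => (S.X j ω, S.u j ω)⟩
  obtain ⟨η, hη, hηH⟩ := exists_markovKernel_eqOn κ (S.filtration.le k _ hH)
    (g := fun ω => g ((T ω).toNNReal, S.X k ω))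
    (hg.comp (hT'.ennreal_toNNReal.prodMk ((S.adapted_X k).mono (S.filtration.le k) le_rfl)))
    fun ω hω => (hGω ω hω).1.isProbabilityMeasure
  obtain ⟨S', hS'⟩ := S.exists_glue k hH η fun ω hω => by
    rw [hηH ω hω]
    exact (hGω ω hω).1
  have hpos : (P ⊗ₘ η) (S'.occurs B h) ≠ 0 := by
    refine compProd_ne_zero hTpos fun ω hω h0 => ?_
    refine (hGω ω hω).2 ?_
    rw [← hηH ω hω]
    refine measure_mono_null ?_ h0
    rintro w ⟨j, hj, hjB⟩
    refine ⟨k + j, ?_, ?_⟩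
    · push_cast
      exact (add_le_add_right hj _).trans (add_tsub_cancel_of_le hk).le
    · rw [hS' ω hω]
      exact hjB
  simp only [reachability, ENNReal.iSup_eq_zero] at hx
  exact hpos (hx _ _ _ S')

end StandardBorel

end DiscreteMDP

/-! ### Integrals of progressive processes -/

section Progressive

variable {Ω V : Type*} [NormedAddCommGroup V] {t : ℝ≥0} {g : ℝ≥0 → Ω → V}

/-- Progressivity gives joint measurability only up to time `t`. Truncating the time extends it to
the line without affecting integrals up to `t`. -/
lemma stronglyMeasurable_uncurry_min {mΩ : MeasurableSpace Ω}
    (hg : StronglyMeasurable fun p : Set.Iic t × Ω => g p.1 p.2) :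
    StronglyMeasurable (Function.uncurry fun (ω : Ω) (r : ℝ) => g (min r.toNNReal t) ω) := by
  have h : Measurable fun p : Ω × ℝ =>
      ((⟨min p.2.toNNReal t, Set.mem_Iic.2 (min_le_right _ _)⟩ : Set.Iic t), p.1) :=
    ((measurable_snd.real_toNNReal.min measurable_const).subtype_mk).prodMk measurable_fst
  exact hg.comp_measurable h

lemma min_toNNReal_of_mem_uIoc {r : ℝ} (hr : r ∈ Set.uIoc (0 : ℝ) t) :
    min r.toNNReal t = r.toNNReal := by
  rw [Set.uIoc_of_le t.coe_nonneg] at hr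
  exact min_eq_left (Real.toNNReal_le_iff_le_coe.2 hr.2)

lemma aestronglyMeasurable_of_progressive {mΩ : MeasurableSpace Ω}
    (hg : StronglyMeasurable fun p : Set.Iic t × Ω => g p.1 p.2) (ω : Ω) :
    AEStronglyMeasurable (fun r : ℝ => g r.toNNReal ω)
      (volume.restrict (Set.uIoc (0 : ℝ) t)) := by
  refine ((stronglyMeasurable_uncurry_min hg).of_uncurry_left (x := ω)).aestronglyMeasurable.congr
    ?_
  filter_upwards [ae_restrict_mem measurableSet_uIoc] with r hr
  rw [min_toNNReal_of_mem_uIoc hr]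

lemma intervalIntegrable_of_progressive {mΩ : MeasurableSpace Ω}
    (hg : StronglyMeasurable fun p : Set.Iic t × Ω => g p.1 p.2) {K : ℝ}
    (hK : ∀ r ω, ‖g r ω‖ ≤ K) (ω : Ω) :
    IntervalIntegrable (fun r : ℝ => g r.toNNReal ω) volume 0 t := by
  rw [intervalIntegrable_iff]
  have h := aestronglyMeasurable_of_progressive hg ω
  rw [Set.uIoc_of_le t.coe_nonneg] at h ⊢
  exact Integrable.of_bound h K (Filter.Eventually.of_forall fun r => hK _ _)

lemma stronglyMeasurable_integral_of_progressive [NormedSpace ℝ V] {mΩ : MeasurableSpace Ω}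
    (hg : StronglyMeasurable fun p : Set.Iic t × Ω => g p.1 p.2) :
    StronglyMeasurable fun ω => ∫ r in (0 : ℝ)..t, g r.toNNReal ω := by
  have h : ∀ ω, ∫ r in (0 : ℝ)..t, g r.toNNReal ω
      = ∫ r in Set.Ioc (0 : ℝ) t, g (min r.toNNReal t) ω := by
    intro ω
    rw [intervalIntegral.integral_of_le t.coe_nonneg]
    refine setIntegral_congr_fun measurableSet_Ioc fun r hr => ?_
    rw [min_toNNReal_of_mem_uIoc (by rwa [Set.uIoc_of_le t.coe_nonneg])]
  simp only [h]
  exact (stronglyMeasurable_uncurry_min hg).integral_prod_right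

/-- The primitive of a bounded process is continuous. -/
lemma continuous_integral_of_forall {g : ℝ≥0 → V} [NormedSpace ℝ V]
    (hg : ∀ t : ℝ≥0, IntervalIntegrable (fun r : ℝ => g r.toNNReal) volume 0 t) :
    Continuous fun t : ℝ≥0 => ∫ r in (0 : ℝ)..t, g r.toNNReal := by
  have h0 : ∀ b : ℝ, IntervalIntegrable (fun r : ℝ => g r.toNNReal) volume 0 b := by
    intro b
    rcases le_total 0 b with hb | hb
    · exact hg ⟨b, hb⟩
    · refine (intervalIntegrable_const (c := g 0)).congr ?_
      intro r hr
      rw [Set.uIoc_of_ge hb] at hr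
      simp [Real.toNNReal_of_nonpos hr.2]
  exact (intervalIntegral.continuous_primitive (fun a b => (h0 a).symm.trans (h0 b)) 0).comp
    NNReal.continuous_coe

end Progressive

namespace ControlledDiffusion

variable {n m : ℕ}

/-! ### The generator in terms of jets -/

/-- The value of a function and its partial derivatives of first and second order. -/
noncomputable def jet (f : EuclideanSpace ℝ (Fin n) → ℝ) (x : EuclideanSpace ℝ (Fin n)) :
    ℝ × (Fin n → ℝ) × (Fin n → Fin n → ℝ) :=
  (f x, fun i => fderiv ℝ f x (EuclideanSpace.single i 1), fun i j =>
    iteratedFDeriv ℝ 2 f x ![EuclideanSpace.single i (1 : ℝ), EuclideanSpace.single j (1 : ℝ)])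

lemma continuous_jet {f : EuclideanSpace ℝ (Fin n) → ℝ}
    (hf : ContDiff ℝ ((⊤ : ℕ∞) : WithTop ℕ∞) f) : Continuous (jet f) := by
  have h1 := hf.continuous_fderiv (by simp)
  have h2 : Continuous fun x => iteratedFDeriv ℝ 2 f x :=
    hf.continuous_iteratedFDeriv (m := 2) (by norm_cast)
  refine hf.continuous.prodMk ((continuous_pi fun i => h1.clm_apply continuous_const).prodMk
    (continuous_pi fun i => continuous_pi fun j => ?_))
  exact (ContinuousMultilinearMap.apply ℝ (fun _ : Fin 2 => EuclideanSpace ℝ (Fin n)) ℝ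
    ![EuclideanSpace.single i (1 : ℝ), EuclideanSpace.single j (1 : ℝ)]).continuous.comp h2

lemma jet_eq_zero {f : EuclideanSpace ℝ (Fin n) → ℝ} {x : EuclideanSpace ℝ (Fin n)}
    (hx : x ∉ tsupport f) : jet f x = 0 := by
  have h0 : f x = 0 := image_eq_zero_of_notMem_tsupport hx
  have h1 : fderiv ℝ f x = 0 := by
    by_contra h
    exact hx (support_fderiv_subset ℝ h)
  have h2 : iteratedFDeriv ℝ 2 f x = 0 := by
    by_contra h
    exact hx (support_iteratedFDeriv_subset 2 h)
  simp only [jet, h0, h1, h2]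
  rfl

variable (D : ControlledDiffusion n m)

/-- The generator as a function of the jet. -/
noncomputable def jetGenerator (u : EuclideanSpace ℝ (Fin m)) (x : EuclideanSpace ℝ (Fin n))
    (j : ℝ × (Fin n → ℝ) × (Fin n → Fin n → ℝ)) : ℝ :=
  ∑ i, D.drift x u i * j.2.1 i +
    (1 / 2) * ∑ i, ∑ k, (D.diffusion x u * (D.diffusion x u).transpose) i k * j.2.2 i k

/-- Seen through the jet, the generator is a continuous function of finitely many real variables, so
bounds and limits of jets carry over to it. -/
lemma generator_eq (u : EuclideanSpace ℝ (Fin m)) (f : EuclideanSpace ℝ (Fin n) → ℝ)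
    (x : EuclideanSpace ℝ (Fin n)) : D.generator u f x = D.jetGenerator u x (jet f x) := by
  rw [generator, jetGenerator, jet]
  congr 1
  conv_lhs => rw [← (EuclideanSpace.basisFun (Fin n) ℝ).sum_repr (D.drift x u)]
  simp

lemma continuous_jetGenerator : Continuous fun p : EuclideanSpace ℝ (Fin m) ×
    EuclideanSpace ℝ (Fin n) × (ℝ × (Fin n → ℝ) × (Fin n → Fin n → ℝ)) =>
      D.jetGenerator p.1 p.2.1 p.2.2 := by
  have hs : Continuous fun p : EuclideanSpace ℝ (Fin m) × EuclideanSpace ℝ (Fin n) ×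
      (ℝ × (Fin n → ℝ) × (Fin n → Fin n → ℝ)) => (p.2.1, p.1) := by fun_prop
  have h1 : Continuous fun p : EuclideanSpace ℝ (Fin m) × EuclideanSpace ℝ (Fin n) ×
      (ℝ × (Fin n → ℝ) × (Fin n → Fin n → ℝ)) => D.drift p.2.1 p.1 :=
    D.continuous_drift.comp hs
  have h2 : Continuous fun p : EuclideanSpace ℝ (Fin m) × EuclideanSpace ℝ (Fin n) ×
      (ℝ × (Fin n → ℝ) × (Fin n → Fin n → ℝ)) => D.diffusion p.2.1 p.1 :=
    D.continuous_diffusion.comp hs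
  have h3 := h2.matrix_mul h2.matrix_transpose
  have h3' : ∀ i k, Continuous fun p : EuclideanSpace ℝ (Fin m) × EuclideanSpace ℝ (Fin n) ×
      (ℝ × (Fin n → ℝ) × (Fin n → Fin n → ℝ)) =>
        (D.diffusion p.2.1 p.1 * (D.diffusion p.2.1 p.1).transpose) i k :=
    fun i k => h3.matrix_elem i k
  unfold jetGenerator
  fun_prop

/-- The drift of `f` along the trajectory: the generator until a terminal state is reached. -/
noncomputable def rate (f : EuclideanSpace ℝ (Fin n) → ℝ) (u : EuclideanSpace ℝ (Fin m))
    (x : EuclideanSpace ℝ (Fin n)) : ℝ :=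
  D.terminalᶜ.indicator (D.generator u f) x

lemma measurable_rate {f : EuclideanSpace ℝ (Fin n) → ℝ}
    (hf : ContDiff ℝ ((⊤ : ℕ∞) : WithTop ℕ∞) f) :
    Measurable fun p : EuclideanSpace ℝ (Fin m) × EuclideanSpace ℝ (Fin n) =>
      D.rate f p.1 p.2 := by
  have h1 : Continuous fun p : EuclideanSpace ℝ (Fin m) × EuclideanSpace ℝ (Fin n) =>
      D.generator p.1 f p.2 := by
    simp only [generator_eq]
    exact D.continuous_jetGenerator.comp (continuous_fst.prodMk (continuous_snd.prodMk
      ((continuous_jet hf).comp continuous_snd)))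
  exact h1.measurable.indicator (measurable_snd D.isClosed_terminal.measurableSet.compl)

/-- The drift is bounded, uniformly in functions with a given support and a bound of the jet. -/
lemma exists_rate_bound (R ρ C : ℝ) : ∃ K : ℝ, 0 ≤ K ∧
    ∀ f : EuclideanSpace ℝ (Fin n) → ℝ, tsupport f ⊆ Metric.closedBall 0 R →
      (∀ x, ‖jet f x‖ ≤ ρ) → ∀ u : EuclideanSpace ℝ (Fin m), ‖u‖ ≤ C → ∀ x,
        ‖D.rate f u x‖ ≤ K := by
  have hc : IsCompact ((Metric.closedBall (0 : EuclideanSpace ℝ (Fin m)) C) ×ˢ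
      ((Metric.closedBall (0 : EuclideanSpace ℝ (Fin n)) R) ×ˢ
        (Metric.closedBall (0 : ℝ × (Fin n → ℝ) × (Fin n → Fin n → ℝ)) ρ))) :=
    (isCompact_closedBall _ _).prod ((isCompact_closedBall _ _).prod (isCompact_closedBall _ _))
  obtain ⟨K, hK⟩ := hc.exists_bound_of_continuousOn D.continuous_jetGenerator.continuousOn
  classical
  refine ⟨max K 0, le_max_right _ _, fun f hf hρ u hu x => ?_⟩
  rw [rate, Set.indicator_apply]
  split_ifs with hx
  · rw [generator_eq]
    by_cases hxs : x ∈ tsupport f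
    · exact (hK (u, x, jet f x) ⟨by simpa using hu, hf hxs, by simpa using hρ x⟩).trans
        (le_max_left _ _)
    · rw [jet_eq_zero hxs]
      simp [jetGenerator]
  · simp

/-! ### Control by the increments of a path -/

/-- A bounded measurable set of actions, with a distinguished element. -/
structure BoundedActions where
  /-- the set of actions -/
  set : Set (EuclideanSpace ℝ (Fin m))
  /-- the distinguished action -/
  default : EuclideanSpace ℝ (Fin m)
  /-- a bound of the actions -/
  bound : ℝ
  measurableSet : MeasurableSet set
  subset : set ⊆ D.actions
  default_mem : default ∈ set
  norm_le : ∀ u ∈ set, ‖u‖ ≤ bound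

variable {D}

/-- The difference quotient from the left of the second component of a path. -/
noncomputable def diffQuot (w : C(ℝ≥0, EuclideanSpace ℝ (Fin n) × EuclideanSpace ℝ (Fin m)))
    (t : ℝ≥0) (k : ℕ) : EuclideanSpace ℝ (Fin m) :=
  ((k : ℝ) + 1) • ((w t).2 - (w (t - 1 / ((k : ℝ≥0) + 1))).2)

namespace BoundedActions

open Classical in
/-- The action at time `t` is the derivative from the left of the second component of the path,
if this is an admissible action. -/
noncomputable def action (𝒰 : D.BoundedActions)
    (w : C(ℝ≥0, EuclideanSpace ℝ (Fin n) × EuclideanSpace ℝ (Fin m))) (t : ℝ≥0) :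
    EuclideanSpace ℝ (Fin m) :=
  if Filter.limUnder Filter.atTop (diffQuot w t) ∈ 𝒰.set then
    Filter.limUnder Filter.atTop (diffQuot w t)
  else 𝒰.default

variable (𝒰 : D.BoundedActions)

lemma action_mem (w : C(ℝ≥0, EuclideanSpace ℝ (Fin n) × EuclideanSpace ℝ (Fin m))) (t : ℝ≥0) :
    𝒰.action w t ∈ 𝒰.set := by
  unfold action
  split_ifs with h
  · exact h
  · exact 𝒰.default_mem

lemma norm_action_le (w : C(ℝ≥0, EuclideanSpace ℝ (Fin n) × EuclideanSpace ℝ (Fin m)))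
    (t : ℝ≥0) : ‖𝒰.action w t‖ ≤ 𝒰.bound := 𝒰.norm_le _ (𝒰.action_mem w t)

lemma action_eq_of_tendsto {w : C(ℝ≥0, EuclideanSpace ℝ (Fin n) × EuclideanSpace ℝ (Fin m))}
    {t : ℝ≥0} {u : EuclideanSpace ℝ (Fin m)}
    (h : Filter.Tendsto (diffQuot w t) Filter.atTop (nhds u)) (hu : u ∈ 𝒰.set) :
    𝒰.action w t = u := by
  rw [action, h.limUnder_eq, if_pos hu]

/-- The limit depends only on late difference quotients. This makes the action insensitive to shifts
of time and to constants added to the second component. -/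
lemma action_congr {w w' : C(ℝ≥0, EuclideanSpace ℝ (Fin n) × EuclideanSpace ℝ (Fin m))}
    {t t' : ℝ≥0} (h : diffQuot w t =ᶠ[Filter.atTop] diffQuot w' t') :
    𝒰.action w t = 𝒰.action w' t' := by
  have : Filter.limUnder Filter.atTop (diffQuot w t) =
      Filter.limUnder Filter.atTop (diffQuot w' t') := by
    rw [Filter.limUnder, Filter.limUnder, Filter.map_congr h]
  rw [action, action, this]

open Classical in
lemma stronglyMeasurable_ite_limUnder {Y : Type*} {mY : MeasurableSpace Y}
    {q : ℕ → Y → EuclideanSpace ℝ (Fin m)} (hq : ∀ k, StronglyMeasurable (q k)) :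
    StronglyMeasurable fun y => if Filter.limUnder Filter.atTop (fun k => q k y) ∈ 𝒰.set then
      Filter.limUnder Filter.atTop (fun k => q k y) else 𝒰.default := by
  have hl := StronglyMeasurable.limUnder (l := Filter.atTop) hq
  exact StronglyMeasurable.ite (hl.measurable 𝒰.measurableSet) hl stronglyMeasurable_const

/-- Difference quotients from the left do not look ahead: they are adapted and continuous in time,
hence progressive, and so is the function of their limit. -/
lemma isStronglyProgressive_action : IsStronglyProgressive
    (pathFiltration (EuclideanSpace ℝ (Fin n) × EuclideanSpace ℝ (Fin m)))
    (fun t w => 𝒰.action w t) := by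
  classical
  have hq : ∀ k : ℕ, IsStronglyProgressive
      (pathFiltration (EuclideanSpace ℝ (Fin n) × EuclideanSpace ℝ (Fin m)))
      (fun t w => diffQuot w t k) := by
    intro k
    refine StronglyAdapted.isStronglyProgressive_of_continuous (fun t => ?_) fun w => ?_
    · have h1 : Measurable[pathFiltration
          (EuclideanSpace ℝ (Fin n) × EuclideanSpace ℝ (Fin m)) t] fun
            w : C(ℝ≥0, EuclideanSpace ℝ (Fin n) × EuclideanSpace ℝ (Fin m)) => diffQuot w t k :=
        ((measurable_pathFiltration_eval le_rfl).snd.sub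
          (measurable_pathFiltration_eval tsub_le_self).snd).const_smul ((k : ℝ) + 1)
      exact h1.stronglyMeasurable
    · unfold diffQuot
      fun_prop
  exact fun t => 𝒰.stronglyMeasurable_ite_limUnder fun k => hq k t

/-! ### The compensated functional of a path -/

/-- The functional of a path whose martingale property expresses that the path is a solution of
the controlled stochastic differential equation. -/
noncomputable def compensated (f : EuclideanSpace ℝ (Fin n) → ℝ) (t : ℝ≥0)
    (w : C(ℝ≥0, EuclideanSpace ℝ (Fin n) × EuclideanSpace ℝ (Fin m))) : ℝ :=
  f (w t).1 - f (w 0).1 -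
    ∫ r in (0 : ℝ)..t, D.rate f (𝒰.action w r.toNNReal) (w r.toNNReal).1

variable {f : EuclideanSpace ℝ (Fin n) → ℝ}

lemma isStronglyProgressive_rate (hf : ContDiff ℝ ((⊤ : ℕ∞) : WithTop ℕ∞) f) :
    IsStronglyProgressive
      (pathFiltration (EuclideanSpace ℝ (Fin n) × EuclideanSpace ℝ (Fin m)))
      (fun t w => D.rate f (𝒰.action w t) (w t).1) := by
  intro t
  have h2 : IsStronglyProgressive
      (pathFiltration (EuclideanSpace ℝ (Fin n) × EuclideanSpace ℝ (Fin m)))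
      (fun t w => w t) :=
    stronglyAdapted_path_eval.isStronglyProgressive_of_continuous fun w => w.continuous
  exact ((D.measurable_rate hf).comp ((𝒰.isStronglyProgressive_action t).measurable.prodMk
    (h2 t).measurable.fst)).stronglyMeasurable

lemma exists_rate_le (hf : ContDiff ℝ ((⊤ : ℕ∞) : WithTop ℕ∞) f) (hfc : HasCompactSupport f) :
    ∃ K : ℝ, 0 ≤ K ∧ ∀ u ∈ 𝒰.set, ∀ x, ‖D.rate f u x‖ ≤ K := by
  obtain ⟨R, hR⟩ := hfc.isCompact.isBounded.subset_closedBall 0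
  have hj : HasCompactSupport (jet f) := HasCompactSupport.intro hfc fun x hx => jet_eq_zero hx
  obtain ⟨ρ, hρ⟩ := hj.exists_bound_of_continuous (continuous_jet hf)
  obtain ⟨K, hK0, hK⟩ := D.exists_rate_bound R ρ 𝒰.bound
  exact ⟨K, hK0, fun u hu x => hK f hR hρ u (𝒰.norm_le u hu) x⟩

lemma intervalIntegrable_rate (hf : ContDiff ℝ ((⊤ : ℕ∞) : WithTop ℕ∞) f)
    (hfc : HasCompactSupport f) (t : ℝ≥0)
    (w : C(ℝ≥0, EuclideanSpace ℝ (Fin n) × EuclideanSpace ℝ (Fin m))) :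
    IntervalIntegrable (fun r : ℝ => D.rate f (𝒰.action w r.toNNReal) (w r.toNNReal).1)
      volume 0 t := by
  obtain ⟨K, -, hK⟩ := 𝒰.exists_rate_le hf hfc
  exact intervalIntegrable_of_progressive
    (g := fun t w => D.rate f (𝒰.action w t) (w t).1) (𝒰.isStronglyProgressive_rate hf t)
    (fun r w => hK _ (𝒰.action_mem w r) _) w

lemma continuous_compensated (hf : ContDiff ℝ ((⊤ : ℕ∞) : WithTop ℕ∞) f)
    (hfc : HasCompactSupport f)
    (w : C(ℝ≥0, EuclideanSpace ℝ (Fin n) × EuclideanSpace ℝ (Fin m))) :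
    Continuous fun t => 𝒰.compensated f t w := by
  have h1 := continuous_integral_of_forall
    (g := fun r => D.rate f (𝒰.action w r) (w r).1)
    fun t => 𝒰.intervalIntegrable_rate hf hfc t w
  exact ((hf.continuous.comp w.continuous.fst).sub continuous_const).sub h1

lemma measurable_compensated (hf : ContDiff ℝ ((⊤ : ℕ∞) : WithTop ℕ∞) f) (t : ℝ≥0) :
    Measurable[pathFiltration (EuclideanSpace ℝ (Fin n) × EuclideanSpace ℝ (Fin m)) t]
      (𝒰.compensated f t) := by
  have h1 := stronglyMeasurable_integral_of_progressive
    (g := fun t w => D.rate f (𝒰.action w t) (w t).1) (𝒰.isStronglyProgressive_rate hf t)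
  have h2 : ∀ r ≤ t, Measurable[pathFiltration
      (EuclideanSpace ℝ (Fin n) × EuclideanSpace ℝ (Fin m)) t] fun
        w : C(ℝ≥0, EuclideanSpace ℝ (Fin n) × EuclideanSpace ℝ (Fin m)) => f (w r).1 :=
    fun r hr => hf.continuous.measurable.comp (measurable_pathFiltration_eval hr).fst
  exact ((h2 t le_rfl).sub (h2 0 zero_le)).sub h1.measurable

lemma norm_compensated_le {K ρ : ℝ} (hK : ∀ u ∈ 𝒰.set, ∀ x, ‖D.rate f u x‖ ≤ K)
    (hρ : ∀ x, ‖f x‖ ≤ ρ) (t : ℝ≥0)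
    (w : C(ℝ≥0, EuclideanSpace ℝ (Fin n) × EuclideanSpace ℝ (Fin m))) :
    ‖𝒰.compensated f t w‖ ≤ 2 * ρ + K * t := by
  have h1 := intervalIntegral.norm_integral_le_of_norm_le_const (a := 0) (b := (t : ℝ))
    (f := fun r : ℝ => D.rate f (𝒰.action w r.toNNReal) (w r.toNNReal).1) (C := K)
    fun r _ => hK _ (𝒰.action_mem w _) _
  rw [sub_zero, abs_of_nonneg t.coe_nonneg] at h1
  have h2 := norm_sub_le (f (w t).1 - f (w 0).1)
    (∫ r in (0 : ℝ)..t, D.rate f (𝒰.action w r.toNNReal) (w r.toNNReal).1)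
  have h3 := norm_sub_le (f (w t).1) (f (w 0).1)
  unfold compensated
  linarith [hρ (w t).1, hρ (w 0).1]

/-- The compensated functional is bounded on bounded intervals of time. -/
lemma exists_compensated_le (hf : ContDiff ℝ ((⊤ : ℕ∞) : WithTop ℕ∞) f)
    (hfc : HasCompactSupport f) (T : ℝ≥0) :
    ∃ K : ℝ, ∀ t ≤ T, ∀ w, ‖𝒰.compensated f t w‖ ≤ K := by
  obtain ⟨K, hK0, hK⟩ := 𝒰.exists_rate_le hf hfc
  obtain ⟨ρ, hρ⟩ := hfc.exists_bound_of_continuous hf.continuous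
  refine ⟨2 * ρ + K * T, fun t ht w => (𝒰.norm_compensated_le hK hρ t w).trans ?_⟩
  gcongr

@[simp] lemma compensated_zero
    (w : C(ℝ≥0, EuclideanSpace ℝ (Fin n) × EuclideanSpace ℝ (Fin m))) :
    𝒰.compensated f 0 w = 0 := by
  simp [compensated]

/-- The compensated functional at time `t` depends only on the path up to time `t`. -/
lemma compensated_congr {w w' : C(ℝ≥0, EuclideanSpace ℝ (Fin n) × EuclideanSpace ℝ (Fin m))}
    {t : ℝ≥0} (h : ∀ r ≤ t, w r = w' r) : 𝒰.compensated f t w = 𝒰.compensated f t w' := by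
  unfold compensated
  rw [h t le_rfl, h 0 zero_le]
  congr 1
  refine intervalIntegral.integral_congr_ae (Filter.Eventually.of_forall fun r hr => ?_)
  rw [Set.uIoc_of_le t.coe_nonneg] at hr
  have hrt : r.toNNReal ≤ t := Real.toNNReal_le_iff_le_coe.2 hr.2
  rw [h _ hrt, 𝒰.action_congr (w' := w') (t' := r.toNNReal)]
  refine Filter.Eventually.of_forall fun k => ?_
  rw [diffQuot, diffQuot, h _ hrt, h _ (tsub_le_self.trans hrt)]

/-- The compensated functional of a path that continues at time `σ` like the path `w`. -/
lemma compensated_add (hf : ContDiff ℝ ((⊤ : ℕ∞) : WithTop ℕ∞) f) (hfc : HasCompactSupport f)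
    {w w' : C(ℝ≥0, EuclideanSpace ℝ (Fin n) × EuclideanSpace ℝ (Fin m))} {σ : ℝ≥0}
    {c : EuclideanSpace ℝ (Fin m)} (h₁ : ∀ r, (w' (σ + r)).1 = (w r).1)
    (h₂ : ∀ r, (w' (σ + r)).2 = (w r).2 + c) (b : ℝ≥0) :
    𝒰.compensated f (σ + b) w' = 𝒰.compensated f σ w' + 𝒰.compensated f b w := by
  -- After `σ`, all sufficiently short steps to the left stay in the shifted part, where the
  -- constant `c` cancels. The excluded time `r = 0` does not matter for the integral.
  have haction : ∀ r : ℝ≥0, 0 < r → 𝒰.action w' (σ + r) = 𝒰.action w r := by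
    intro r hr
    refine 𝒰.action_congr ?_
    have h0 : Filter.Tendsto (fun k : ℕ => 1 / ((k : ℝ≥0) + 1)) Filter.atTop (nhds 0) :=
      tendsto_one_div_add_atTop_nhds_zero_nat
    filter_upwards [h0.eventually (gt_mem_nhds hr)] with k hk
    rw [diffQuot, diffQuot, add_tsub_assoc_of_le hk.le, h₂, h₂, add_sub_add_right_eq_sub]
  have hint := 𝒰.intervalIntegrable_rate hf hfc (σ + b) w'
  have hint₁ := 𝒰.intervalIntegrable_rate hf hfc σ w'
  have hadd := intervalIntegral.integral_add_adjacent_intervals hint₁ (hint₁.symm.trans hint)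
  have hshift : ∫ r in (σ : ℝ)..((σ + b : ℝ≥0) : ℝ),
      D.rate f (𝒰.action w' r.toNNReal) (w' r.toNNReal).1 =
        ∫ r in (0 : ℝ)..b, D.rate f (𝒰.action w r.toNNReal) (w r.toNNReal).1 := by
    have h3 := intervalIntegral.integral_comp_add_right (a := 0) (b := (b : ℝ))
      (fun r : ℝ => D.rate f (𝒰.action w' r.toNNReal) (w' r.toNNReal).1) (σ : ℝ)
    rw [zero_add, add_comm (b : ℝ)] at h3
    rw [NNReal.coe_add, ← h3]
    refine intervalIntegral.integral_congr_ae (Filter.Eventually.of_forall fun r hr => ?_)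
    rw [Set.uIoc_of_le b.coe_nonneg] at hr
    have h4 : (r + σ).toNNReal = σ + r.toNNReal := by
      rw [Real.toNNReal_add hr.1.le σ.coe_nonneg, Real.toNNReal_coe, add_comm]
    simp only [h4, h₁, haction _ (Real.toNNReal_pos.2 hr.1)]
  have h5 : (w' σ).1 = (w 0).1 := by simpa using h₁ 0
  simp only [compensated]
  rw [← hadd, hshift, h₁, h5]
  ring

end BoundedActions

end ControlledDiffusion

/-! ### Rational approximation from the right -/

/-- The first multiple of `1 / (k + 1)` that exceeds `r`. -/
noncomputable def gridPoint (r : ℝ≥0) (k : ℕ) : ℝ≥0 :=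
  ((⌊r * (k + 1)⌋₊ + 1 : ℕ) : ℝ≥0) / (k + 1)

lemma le_gridPoint (r : ℝ≥0) (k : ℕ) : r ≤ gridPoint r k := by
  rw [gridPoint, le_div_iff₀ (by positivity)]
  push_cast
  exact (Nat.lt_floor_add_one _).le

lemma gridPoint_le (r : ℝ≥0) (k : ℕ) : gridPoint r k ≤ r + 1 / ((k : ℝ≥0) + 1) := by
  have h1 : r + 1 / ((k : ℝ≥0) + 1) = (r * (k + 1) + 1) / (k + 1) := by
    field_simp
  rw [h1, gridPoint]
  push_cast
  gcongr
  exact Nat.floor_le zero_le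

lemma tendsto_gridPoint (r : ℝ≥0) : Filter.Tendsto (gridPoint r) Filter.atTop (nhds r) := by
  refine tendsto_of_tendsto_of_tendsto_of_le_of_le tendsto_const_nhds ?_ (le_gridPoint r)
    (gridPoint_le r)
  have h0 : Filter.Tendsto (fun k : ℕ => 1 / ((k : ℝ≥0) + 1)) Filter.atTop (nhds 0) :=
    tendsto_one_div_add_atTop_nhds_zero_nat
  simpa using h0.const_add r

namespace ControlledDiffusion

variable {n m : ℕ}

/-! ### Countably many test functions suffice -/

/-- The test functions are separable in the topology of locally uniform convergence of jets. -/
lemma exists_countable_tests (n : ℕ) : ∃ 𝓕 : Set (EuclideanSpace ℝ (Fin n) → ℝ), 𝓕.Countable ∧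
    (∀ f ∈ 𝓕, ContDiff ℝ ((⊤ : ℕ∞) : WithTop ℕ∞) f ∧ HasCompactSupport f) ∧
    ∀ f : EuclideanSpace ℝ (Fin n) → ℝ, ContDiff ℝ ((⊤ : ℕ∞) : WithTop ℕ∞) f →
      HasCompactSupport f → ∃ (g : ℕ → EuclideanSpace ℝ (Fin n) → ℝ) (R ρ : ℝ),
        (∀ k, g k ∈ 𝓕 ∧ tsupport (g k) ⊆ Metric.closedBall 0 R ∧ ∀ x, ‖jet (g k) x‖ ≤ ρ) ∧
        ∀ x, Filter.Tendsto (fun k => jet (g k) x) Filter.atTop (nhds (jet f x)) := by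
  let TR : ℕ → Type := fun R => {f : EuclideanSpace ℝ (Fin n) → ℝ //
    ContDiff ℝ ((⊤ : ℕ∞) : WithTop ℕ∞) f ∧ tsupport f ⊆ Metric.closedBall 0 R}
  let J : ∀ R, TR R → C(EuclideanSpace ℝ (Fin n), ℝ × (Fin n → ℝ) × (Fin n → Fin n → ℝ)) :=
    fun R f => ⟨jet f.1, continuous_jet f.2.1⟩
  let tR : ∀ R, TopologicalSpace (TR R) := fun R => TopologicalSpace.induced (J R) inferInstance
  have hsc : ∀ R, SecondCountableTopology (TR R) := fun R =>
    TopologicalSpace.secondCountableTopology_induced _ _ (J R)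
  have hJ : ∀ R, Continuous (J R) := fun R => continuous_induced_dom
  choose S hSc hSd using fun R => TopologicalSpace.exists_countable_dense (TR R)
  have hcs : ∀ R (f : TR R), HasCompactSupport f.1 := fun R f =>
    (isCompact_closedBall _ _).of_isClosed_subset (isClosed_tsupport _) f.2.2
  refine ⟨⋃ R, Subtype.val '' S R, Set.countable_iUnion fun R => (hSc R).image _, ?_, ?_⟩
  · intro f hf
    obtain ⟨R, f, -, rfl⟩ := Set.mem_iUnion.1 hf
    exact ⟨f.2.1, hcs R f⟩
  · intro f hf hfc
    obtain ⟨R, hR⟩ := hfc.isCompact.isBounded.subset_closedBall 0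
    obtain ⟨N, hN⟩ := exists_nat_ge R
    let f' : TR N := ⟨f, hf, hR.trans (Metric.closedBall_subset_closedBall hN)⟩
    obtain ⟨g, hgS, hg⟩ := mem_closure_iff_seq_limit.1 (hSd N f')
    have hlim := ((hJ N).tendsto f').comp hg
    have hjc : HasCompactSupport (jet f) :=
      HasCompactSupport.intro hfc fun x hx => jet_eq_zero hx
    obtain ⟨ρ, hρ⟩ := hjc.exists_bound_of_continuous (continuous_jet hf)
    have hρ0 : 0 ≤ ρ := (norm_nonneg _).trans (hρ 0)
    have hunif := ContinuousMap.tendsto_iff_forall_isCompact_tendstoUniformlyOn.1 hlim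
      (Metric.closedBall 0 N) (isCompact_closedBall _ _)
    rw [Metric.tendstoUniformlyOn_iff] at hunif
    obtain ⟨k₀, hk₀⟩ := Filter.eventually_atTop.1 (hunif 1 one_pos)
    -- Uniform convergence on the ball bounds the jets by `ρ + 1` only from the index `k₀` on.
    refine ⟨fun k => (g (k + k₀)).1, N, ρ + 1, fun k => ⟨?_, (g (k + k₀)).2.2, fun x => ?_⟩,
      fun x => ?_⟩
    · exact Set.mem_iUnion.2 ⟨N, _, hgS _, rfl⟩
    · by_cases hx : x ∈ Metric.closedBall (0 : EuclideanSpace ℝ (Fin n)) (N : ℝ)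
      · have h1 := hk₀ (k + k₀) (Nat.le_add_left _ _) x hx
        have h2 : ‖jet f x - jet (g (k + k₀)).1 x‖ < 1 := by
          rw [← dist_eq_norm]
          exact h1
        have h3 := norm_sub_norm_le (jet (g (k + k₀)).1 x) (jet f x)
        rw [norm_sub_rev] at h3
        linarith [hρ x]
      · rw [jet_eq_zero fun h => hx ((g (k + k₀)).2.2 h), norm_zero]
        linarith
    · have h1 := ((continuous_eval_const x).tendsto (J N f')).comp hlim
      exact h1.comp (Filter.tendsto_add_atTop_nat k₀)

namespace BoundedActions

variable {D : ControlledDiffusion n m} (𝒰 : D.BoundedActions)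

/-- The compensated functionals of `f` form a martingale along the random path `Y`. -/
def HasMartingale (f : EuclideanSpace ℝ (Fin n) → ℝ) {Ω : Type*} {mΩ : MeasurableSpace Ω}
    (P : Measure Ω) (F : Filtration ℝ≥0 mΩ)
    (Y : Ω → C(ℝ≥0, EuclideanSpace ℝ (Fin n) × EuclideanSpace ℝ (Fin m))) : Prop :=
  ∀ s t, s ≤ t → ∀ A, MeasurableSet[F s] A →
    ∫ ω in A, 𝒰.compensated f t (Y ω) ∂P = ∫ ω in A, 𝒰.compensated f s (Y ω) ∂P

/-- The random path `Y` is a weak solution of the controlled equation that starts at `x`, under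
the control by the increments of its second component. -/
structure IsControlled (x : EuclideanSpace ℝ (Fin n)) {Ω : Type*} {mΩ : MeasurableSpace Ω}
    (P : Measure Ω) (F : Filtration ℝ≥0 mΩ)
    (Y : Ω → C(ℝ≥0, EuclideanSpace ℝ (Fin n) × EuclideanSpace ℝ (Fin m))) : Prop where
  isProbabilityMeasure : IsProbabilityMeasure P
  adapted : ∀ t, Measurable[F t] fun ω => Y ω t
  initial : ∀ᵐ ω ∂P, (Y ω 0).1 = x
  absorbed : ∀ᵐ ω ∂P, ∀ s t : ℝ≥0, s ≤ t → (Y ω s).1 ∈ D.terminal → (Y ω t).1 = (Y ω s).1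
  hasMartingale : ∀ f : EuclideanSpace ℝ (Fin n) → ℝ,
    ContDiff ℝ ((⊤ : ℕ∞) : WithTop ℕ∞) f → HasCompactSupport f → 𝒰.HasMartingale f P F Y

/-- `Q` is the law of the paths of a weak solution of the controlled equation. -/
def IsLaw (x : EuclideanSpace ℝ (Fin n))
    (Q : Measure C(ℝ≥0, EuclideanSpace ℝ (Fin n) × EuclideanSpace ℝ (Fin m))) : Prop :=
  𝒰.IsControlled x Q (pathFiltration _) id

section

variable {Ω : Type*} {mΩ : MeasurableSpace Ω} {P : Measure Ω} {F : Filtration ℝ≥0 mΩ}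
  {Y : Ω → C(ℝ≥0, EuclideanSpace ℝ (Fin n) × EuclideanSpace ℝ (Fin m))}

lemma measurable_of_adapted (hY : ∀ t, Measurable[F t] fun ω => Y ω t) : Measurable Y :=
  measurable_path_iff.2 fun t => (hY t).mono (F.le t) le_rfl

lemma measurable_compensated_comp (hY : ∀ t, Measurable[F t] fun ω => Y ω t)
    {f : EuclideanSpace ℝ (Fin n) → ℝ} (hf : ContDiff ℝ ((⊤ : ℕ∞) : WithTop ℕ∞) f) (t : ℝ≥0) :
    Measurable[F t] fun ω => 𝒰.compensated f t (Y ω) :=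
  (𝒰.measurable_compensated hf t).comp (measurable_path_of_adapted F hY t)

lemma measurable_compensated' {f : EuclideanSpace ℝ (Fin n) → ℝ}
    (hf : ContDiff ℝ ((⊤ : ℕ∞) : WithTop ℕ∞) f) (t : ℝ≥0) : Measurable (𝒰.compensated f t) :=
  (𝒰.measurable_compensated hf t).mono ((pathFiltration _).le t) le_rfl

/-- It suffices to check the martingale property for a dense set of test functions. -/
lemma hasMartingale_of_tendsto [IsFiniteMeasure P] (hY : Measurable Y)
    {f : EuclideanSpace ℝ (Fin n) → ℝ} {g : ℕ → EuclideanSpace ℝ (Fin n) → ℝ} {R ρ : ℝ}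
    (hgc : ∀ k, ContDiff ℝ ((⊤ : ℕ∞) : WithTop ℕ∞) (g k)) (hgcs : ∀ k, HasCompactSupport (g k))
    (hgs : ∀ k, tsupport (g k) ⊆ Metric.closedBall 0 R) (hgρ : ∀ k x, ‖jet (g k) x‖ ≤ ρ)
    (hlim : ∀ x, Filter.Tendsto (fun k => jet (g k) x) Filter.atTop (nhds (jet f x)))
    (hg : ∀ k, 𝒰.HasMartingale (g k) P F Y) : 𝒰.HasMartingale f P F Y := by
  -- The common support and bound of the jets yield one constant that dominates all rates, both in
  -- the time integral and under the expectation.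
  obtain ⟨K, hK0, hK⟩ := D.exists_rate_bound R ρ 𝒰.bound
  have hKr : ∀ k, ∀ u ∈ 𝒰.set, ∀ x, ‖D.rate (g k) u x‖ ≤ K := fun k u hu x =>
    hK (g k) (hgs k) (hgρ k) u (𝒰.norm_le u hu) x
  have hρ : ∀ k x, ‖g k x‖ ≤ ρ := fun k x => (norm_fst_le (jet (g k) x)).trans (hgρ k x)
  have hval : ∀ x, Filter.Tendsto (fun k => g k x) Filter.atTop (nhds (f x)) := fun x =>
    (continuous_fst.tendsto _).comp (hlim x)
  have hrate : ∀ u x, Filter.Tendsto (fun k => D.rate (g k) u x) Filter.atTop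
      (nhds (D.rate f u x)) := by
    intro u x
    by_cases hx : x ∈ D.terminalᶜ
    · simp only [rate, Set.indicator_of_mem hx, generator_eq]
      have hc : Continuous fun j => D.jetGenerator u x j :=
        D.continuous_jetGenerator.comp (continuous_const.prodMk (continuous_const.prodMk
          continuous_id))
      exact (hc.tendsto (jet f x)).comp (hlim x)
    · simp only [rate, Set.indicator_of_notMem hx]
      exact tendsto_const_nhds
  have hcomp : ∀ t w, Filter.Tendsto (fun k => 𝒰.compensated (g k) t w) Filter.atTop
      (nhds (𝒰.compensated f t w)) := by
    intro t w
    refine ((hval _).sub (hval _)).sub ?_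
    refine intervalIntegral.tendsto_integral_filter_of_dominated_convergence (fun _ => K)
      (Filter.Eventually.of_forall fun k => ?_) (Filter.Eventually.of_forall fun k =>
        Filter.Eventually.of_forall fun r _ => hKr k _ (𝒰.action_mem w _) _)
      intervalIntegrable_const (Filter.Eventually.of_forall fun r _ => hrate _ _)
    exact (intervalIntegrable_iff.1 (𝒰.intervalIntegrable_rate (hgc k) (hgcs k) t w)).1
  have hint : ∀ t A, Filter.Tendsto (fun k => ∫ ω in A, 𝒰.compensated (g k) t (Y ω) ∂P)
      Filter.atTop (nhds (∫ ω in A, 𝒰.compensated f t (Y ω) ∂P)) := by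
    intro t A
    refine tendsto_integral_of_dominated_convergence (fun _ => 2 * ρ + K * t)
      (fun k => ((𝒰.measurable_compensated' (hgc k) t).comp hY).aestronglyMeasurable)
      (integrable_const _) (fun k => Filter.Eventually.of_forall fun ω => ?_)
      (Filter.Eventually.of_forall fun ω => hcomp t (Y ω))
    exact 𝒰.norm_compensated_le (hKr k) (hρ k) t (Y ω)
  intro s t hst A hA
  refine tendsto_nhds_unique ((hint t A).congr fun k => ?_) (hint s A)
  exact hg k s t hst A hA

/-- A martingale in terms of increments between rational times. -/
lemma hasMartingale_iff_rat [IsFiniteMeasure P] (hY : Measurable Y)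
    {f : EuclideanSpace ℝ (Fin n) → ℝ} (hf : ContDiff ℝ ((⊤ : ℕ∞) : WithTop ℕ∞) f)
    (hfc : HasCompactSupport f) : 𝒰.HasMartingale f P F Y ↔
      ∀ k a b : ℕ, a ≤ b → ∀ A, MeasurableSet[F (a / (k + 1))] A →
        ∫ ω in A, (𝒰.compensated f (b / (k + 1)) (Y ω) - 𝒰.compensated f (a / (k + 1)) (Y ω)) ∂P
          = 0 := by
  have hint : ∀ t A, Integrable (fun ω => 𝒰.compensated f t (Y ω)) (P.restrict A) := by
    intro t A
    obtain ⟨K, hK⟩ := 𝒰.exists_compensated_le hf hfc t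
    exact Integrable.of_bound ((𝒰.measurable_compensated' hf t).comp hY).aestronglyMeasurable K
      (Filter.Eventually.of_forall fun ω => hK t le_rfl (Y ω))
  constructor
  · intro h k a b hab A hA
    rw [integral_sub (hint _ _) (hint _ _), sub_eq_zero]
    exact h _ _ (by gcongr) A hA
  · intro h s t hst A hA
    have hlim : ∀ r, Filter.Tendsto (fun k => ∫ ω in A, 𝒰.compensated f (gridPoint r k) (Y ω) ∂P)
        Filter.atTop (nhds (∫ ω in A, 𝒰.compensated f r (Y ω) ∂P)) := by
      intro r
      obtain ⟨K, hK⟩ := 𝒰.exists_compensated_le hf hfc (r + 1)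
      refine tendsto_integral_of_dominated_convergence (fun _ => K)
        (fun k => ((𝒰.measurable_compensated' hf _).comp hY).aestronglyMeasurable)
        (integrable_const _) (fun k => Filter.Eventually.of_forall fun ω => hK _ ?_ _)
        (Filter.Eventually.of_forall fun ω => ?_)
      · refine (gridPoint_le r k).trans ?_
        gcongr
        rw [div_le_one (by positivity)]
        simp
      · exact ((𝒰.continuous_compensated hf hfc (Y ω)).tendsto r).comp (tendsto_gridPoint r)
    refine tendsto_nhds_unique (hlim t) ((hlim s).congr fun k => ?_)
    -- Both times are rounded up on the same grid. Upward rounding keeps `A` known at the rounded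
    -- time, and continuity recovers `s` and `t`.
    have h1 := h k (⌊s * (k + 1)⌋₊ + 1) (⌊t * (k + 1)⌋₊ + 1) (by gcongr) A
      (F.mono (le_gridPoint s k) A hA)
    rw [integral_sub (hint _ _) (hint _ _), sub_eq_zero] at h1
    exact h1.symm

end

/-! ### The laws of solutions form a measurable set -/

/-- The set of paths that are frozen from the moment they reach a terminal state. -/
def absorbedPaths (D : ControlledDiffusion n m) :
    Set C(ℝ≥0, EuclideanSpace ℝ (Fin n) × EuclideanSpace ℝ (Fin m)) :=
  {w | ∀ s t : ℝ≥0, s ≤ t → (w s).1 ∈ D.terminal → (w t).1 = (w s).1}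

/-- It suffices to compare grid times: if a terminal state was reached by the earlier one, the
states at both agree. As the terminal set is closed, its being reached is measurable, and continuity
yields all times. -/
lemma measurableSet_absorbedPaths : MeasurableSet (absorbedPaths D) := by
  have h : absorbedPaths D = ⋂ (k : ℕ) (a : ℕ) (b : ℕ) (_ : a ≤ b),
      ({w | ∃ s ≤ (a / (k + 1) : ℝ≥0), (s, (w s).1) ∈ Set.univ ×ˢ D.terminal}ᶜ ∪
        {w | (w (b / (k + 1))).1 = (w (a / (k + 1))).1}) := by
    ext w
    simp only [absorbedPaths, Set.mem_iInter, Set.mem_union, Set.mem_compl_iff,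
      Set.mem_ofPred_eq, Set.mem_prod, Set.mem_univ, true_and]
    constructor
    · intro h k a b hab
      rw [or_iff_not_imp_left, not_not]
      rintro ⟨s, hs, hsF⟩
      have hab' : (a / (k + 1) : ℝ≥0) ≤ b / (k + 1) := by gcongr
      rw [h s _ (hs.trans hab') hsF, h s _ hs hsF]
    · intro h s t hst hsF
      have hlim : ∀ r, Filter.Tendsto (fun k => (w (gridPoint r k)).1) Filter.atTop (nhds (w r).1) :=
        fun r => (w.continuous.fst.tendsto r).comp (tendsto_gridPoint r)
      refine tendsto_nhds_unique (hlim t) ((hlim s).congr fun k => ?_)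
      have h1 := h k (⌊s * (k + 1)⌋₊ + 1) (⌊t * (k + 1)⌋₊ + 1) (by gcongr)
      rw [or_iff_not_imp_left, not_not] at h1
      exact (h1 ⟨s, le_gridPoint s k, hsF⟩).symm
  rw [h]
  have heval : ∀ r, Measurable fun
      w : C(ℝ≥0, EuclideanSpace ℝ (Fin n) × EuclideanSpace ℝ (Fin m)) => (w r).1 :=
    fun r => (continuous_eval_const r).measurable.fst
  refine .iInter fun k => .iInter fun a => .iInter fun b => .iInter fun _ => ?_
  refine MeasurableSet.union (MeasurableSet.compl ?_) (measurableSet_eq_fun (heval _) (heval _))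
  exact measurableSet_hit (X := fun r
    (w : C(ℝ≥0, EuclideanSpace ℝ (Fin n) × EuclideanSpace ℝ (Fin m))) => (w r).1)
    (fun s _ => heval s) (fun w => w.continuous.fst) (isClosed_univ.prod D.isClosed_terminal)

/-- The martingale problem reduces to countably many test functions and grid times. For each of
these the condition on all past events is measurable, since the past is countably generated. -/
lemma measurableSet_isLaw {Z : Type*} [MeasurableSpace Z]
    (κ : Kernel Z C(ℝ≥0, EuclideanSpace ℝ (Fin n) × EuclideanSpace ℝ (Fin m)))
    [IsFiniteKernel κ] :
    MeasurableSet {p : EuclideanSpace ℝ (Fin n) × Z | 𝒰.IsLaw p.1 (κ p.2)} := by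
  obtain ⟨𝓕, h𝓕, h𝓕t, h𝓕d⟩ := exists_countable_tests n
  have h1 : MeasurableSet {z | κ z Set.univ = 1} :=
    κ.measurable_coe .univ (measurableSet_singleton 1)
  have h2 : MeasurableSet {p : EuclideanSpace ℝ (Fin n) × Z | κ p.2 {w | (w 0).1 ≠ p.1} = 0} := by
    have hs : MeasurableSet {q : (EuclideanSpace ℝ (Fin n) × Z) ×
        C(ℝ≥0, EuclideanSpace ℝ (Fin n) × EuclideanSpace ℝ (Fin m)) | (q.2 0).1 ≠ q.1.1} :=
      (measurableSet_eq_fun ((continuous_eval_const 0).measurable.comp measurable_snd).fst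
        measurable_fst.fst).compl
    exact (Kernel.measurable_kernel_prodMk_left (κ := κ.comap Prod.snd measurable_snd) hs)
      (measurableSet_singleton 0)
  have h3 : MeasurableSet {z | κ z (absorbedPaths D)ᶜ = 0} :=
    κ.measurable_coe measurableSet_absorbedPaths.compl (measurableSet_singleton 0)
  have h4 : MeasurableSet {z | ∀ f ∈ 𝓕, ∀ k a b : ℕ, a ≤ b → ∀ A,
      MeasurableSet[pathFiltration (EuclideanSpace ℝ (Fin n) × EuclideanSpace ℝ (Fin m))
        (a / (k + 1))] A →
        ∫ w in A, (𝒰.compensated f (b / (k + 1)) w - 𝒰.compensated f (a / (k + 1)) w) ∂(κ z)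
          = 0} := by
    simp only [Set.ofPred_forall]
    refine .biInter h𝓕 fun f hf => .iInter fun k => .iInter fun a => .iInter fun b =>
      .iInter fun hab => ?_
    obtain ⟨hfc, hfs⟩ := h𝓕t f hf
    have hm : Measurable fun w =>
        𝒰.compensated f (b / (k + 1)) w - 𝒰.compensated f (a / (k + 1)) w :=
      (𝒰.measurable_compensated' hfc _).sub (𝒰.measurable_compensated' hfc _)
    have := measurableSet_forall_setIntegral_eq_zero κ
      (measurable_stopPath (V := EuclideanSpace ℝ (Fin n) × EuclideanSpace ℝ (Fin m))
        (a / (k + 1))) hm fun z => ?_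
    · simp only [Set.ofPred_forall] at this
      exact this
    · obtain ⟨K, hK⟩ := 𝒰.exists_compensated_le hfc hfs (b / (k + 1))
      refine Integrable.of_bound hm.aestronglyMeasurable (K + K)
        (Filter.Eventually.of_forall fun w => ?_)
      exact (norm_sub_le _ _).trans (add_le_add (hK _ le_rfl w) (hK _ (by gcongr) w))
  convert (measurable_snd h1).inter (h2.inter ((measurable_snd h3).inter (measurable_snd h4)))
    using 1
  ext ⟨x, z⟩
  simp only [Set.mem_inter_iff, Set.mem_preimage]
  constructor
  · intro h
    have h' : 𝒰.IsLaw x (κ z) := h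
    have := h'.isProbabilityMeasure
    refine ⟨h'.1.1, h'.initial, h'.absorbed, fun f hf => ?_⟩
    exact (𝒰.hasMartingale_iff_rat measurable_id (h𝓕t f hf).1 (h𝓕t f hf).2).1
      (h'.hasMartingale f (h𝓕t f hf).1 (h𝓕t f hf).2)
  · rintro ⟨h1, h2, h3, h4⟩
    have hp : IsProbabilityMeasure (κ z) := ⟨h1⟩
    refine ⟨hp, fun t => measurable_pathFiltration_eval le_rfl, h2, h3, fun f hf hfc => ?_⟩
    obtain ⟨g, R, ρ, hg, hlim⟩ := h𝓕d f hf hfc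
    refine 𝒰.hasMartingale_of_tendsto measurable_id (fun k => (h𝓕t _ (hg k).1).1)
      (fun k => (h𝓕t _ (hg k).1).2) (fun k => (hg k).2.1) (fun k => (hg k).2.2) hlim fun k => ?_
    exact (𝒰.hasMartingale_iff_rat measurable_id (h𝓕t _ (hg k).1).1 (h𝓕t _ (hg k).1).2).2
      (h4 _ (hg k).1)

end BoundedActions

end ControlledDiffusion

/-! ### Stopped martingales -/

/-- Optional stopping of a bounded continuous martingale. -/
lemma setIntegral_stopped_eq {Ω : Type*} {mΩ : MeasurableSpace Ω} {P : Measure Ω}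
    [IsFiniteMeasure P] {F : Filtration ℝ≥0 mΩ} {M : ℝ≥0 → Ω → ℝ} (hm : ∀ t, Measurable (M t))
    (hc : ∀ ω, Continuous fun t => M t ω) {s t : ℝ≥0} {K : ℝ} (hK : ∀ r ≤ t, ∀ ω, ‖M r ω‖ ≤ K)
    (hM : ∀ r r', r ≤ r' → ∀ A, MeasurableSet[F r] A →
      ∫ ω in A, M r' ω ∂P = ∫ ω in A, M r ω ∂P)
    {T : Ω → ℝ≥0∞} (hT : ∀ r : ℝ≥0, MeasurableSet[F r] {ω | T ω ≤ r}) (hst : s ≤ t) {A : Set Ω}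
    (hA : MeasurableSet[F s] A) (hAT : ∀ ω ∈ A, (s : ℝ≥0∞) < T ω) :
    ∫ ω in A, M (min (t : ℝ≥0∞) (T ω)).toNNReal ω ∂P = ∫ ω in A, M s ω ∂P := by
  have hA' : MeasurableSet A := F.le s A hA
  let δ : ℕ → ℝ≥0 := fun N => (t - s) / (N + 1)
  let g : ℕ → ℕ → ℝ≥0 := fun N j => s + j * δ N
  have hgs : ∀ N j, g N (j + 1) = g N j + δ N := fun N j => by
    simp only [g]
    push_cast
    ring
  have hgmono : ∀ N j, g N j ≤ g N (j + 1) := fun N j => by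
    rw [hgs]
    exact le_self_add
  have hgN : ∀ N, g N (N + 1) = t := fun N => by
    simp only [g, δ]
    push_cast
    rw [mul_div_cancel₀ _ (by positivity), add_tsub_cancel_of_le hst]
  -- A discrete clock that advances along the grid while `T` lies ahead. On `A` it exceeds the
  -- minimum of `g N j` and `T` by at most one mesh width.
  let σ : ℕ → ℕ → Ω → ℝ≥0 := fun N j ω =>
    Nat.rec s (fun j r => if (g N j : ℝ≥0∞) < T ω then g N (j + 1) else r) j
  have hσs : ∀ N j ω, σ N (j + 1) ω = if (g N j : ℝ≥0∞) < T ω then g N (j + 1) else σ N j ω :=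
    fun _ _ _ => rfl
  have hσ_eq : ∀ N j ω, (g N j : ℝ≥0∞) < T ω → σ N j ω = g N j := by
    intro N j ω h
    cases j with
    | zero => simp [σ, g]
    | succ j =>
      rw [hσs, if_pos (lt_of_le_of_lt (ENNReal.coe_le_coe.2 (hgmono N j)) h)]
  have hσ_le : ∀ N j ω, σ N j ω ≤ g N j := by
    intro N j ω
    induction j with
    | zero => simp [σ, g]
    | succ j ih =>
      rw [hσs]
      split_ifs
      · exact le_rfl
      · exact ih.trans (hgmono N j)
  have hbet : ∀ N j, ∀ ω ∈ A, (min (g N j : ℝ≥0∞) (T ω)).toNNReal ≤ σ N j ω ∧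
      σ N j ω ≤ (min (g N j : ℝ≥0∞) (T ω)).toNNReal + δ N := by
    intro N j ω hω
    induction j with
    | zero =>
      have : σ N 0 ω = s := rfl
      simp [this, g, min_eq_left (hAT ω hω).le]
    | succ j ih =>
      rw [hσs]
      split_ifs with h
      · constructor
        · exact ENNReal.toNNReal_mono ENNReal.coe_ne_top (min_le_left _ _)
        · rw [hgs]
          gcongr
          rw [← ENNReal.coe_le_coe, ENNReal.coe_toNNReal
            (ne_top_of_le_ne_top ENNReal.coe_ne_top (min_le_left _ _))]
          exact le_min (ENNReal.coe_le_coe.2 le_self_add) h.le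
      · rw [not_lt] at h
        rw [min_eq_right h] at ih
        rwa [min_eq_right (h.trans (ENNReal.coe_le_coe.2 (hgmono N j)))]
  have hTm : ∀ r : ℝ≥0, MeasurableSet[F r] {ω | (r : ℝ≥0∞) < T ω} := fun r => by
    convert (hT r).compl using 1
    ext ω
    simp
  have hσm : ∀ N j, Measurable fun ω => M (σ N j ω) ω := by
    intro N j
    induction j with
    | zero => exact hm s
    | succ j ih =>
      have h1 : (fun ω => M (σ N (j + 1) ω) ω) = fun ω =>
          if (g N j : ℝ≥0∞) < T ω then M (g N (j + 1)) ω else M (σ N j ω) ω := by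
        ext ω
        rw [hσs]
        split_ifs <;> rfl
      rw [h1]
      exact Measurable.ite (F.le _ _ (hTm _)) (hm _) ih
  have hgt : ∀ N j, j ≤ N + 1 → g N j ≤ t := fun N j hj => by
    rw [← hgN N]
    exact monotone_nat_of_le_succ (hgmono N) hj
  have hint : ∀ {f : Ω → ℝ}, Measurable f → (∀ ω, ‖f ω‖ ≤ K) → ∀ B, Integrable f (P.restrict B) :=
    fun hf hfK B => Integrable.of_bound hf.aestronglyMeasurable K (Filter.Eventually.of_forall hfK)
  have hσi : ∀ N j, j ≤ N + 1 → ∫ ω in A, M (σ N j ω) ω ∂P = ∫ ω in A, M s ω ∂P := by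
    intro N j
    induction j with
    | zero => intro _; rfl
    | succ j ih =>
      intro hj
      have hj' : j ≤ N + 1 := (Nat.le_succ j).trans hj
      rw [← ih hj', ← sub_eq_zero, ← integral_sub
        (hint (hσm N (j + 1)) (fun ω => hK _ ((hσ_le N (j + 1) ω).trans (hgt N _ hj)) ω) A)
        (hint (hσm N j) (fun ω => hK _ ((hσ_le N j ω).trans (hgt N _ hj')) ω) A)]
      -- Each increment is restricted to the event that `T` exceeds `g N j`, which is known at time
      -- `g N j`, so the martingale property applies.
      have h1 : ∀ ω, M (σ N (j + 1) ω) ω - M (σ N j ω) ω =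
          {ω | (g N j : ℝ≥0∞) < T ω}.indicator
            (fun ω => M (g N (j + 1)) ω - M (g N j) ω) ω := by
        intro ω
        by_cases h : (g N j : ℝ≥0∞) < T ω
        · rw [Set.indicator_of_mem (show ω ∈ {ω | (g N j : ℝ≥0∞) < T ω} from h), hσs, if_pos h,
            hσ_eq N j ω h]
        · rw [Set.indicator_of_notMem (show ω ∉ {ω | (g N j : ℝ≥0∞) < T ω} from h), hσs, if_neg h,
            sub_self]
      simp only [h1]
      have hgj : s ≤ g N j := le_self_add
      rw [setIntegral_indicator (F.le _ _ (hTm _)),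
        integral_sub (hint (hm _) (hK _ (hgt N _ hj)) _) (hint (hm _) (hK _ (hgt N _ hj')) _),
        sub_eq_zero]
      exact hM _ _ (hgmono N j) _ (MeasurableSet.inter (F.mono hgj A hA) (hTm _))
  have hδ : Filter.Tendsto δ Filter.atTop (nhds 0) := by
    have h0 : Filter.Tendsto (fun k : ℕ => 1 / ((k : ℝ≥0) + 1)) Filter.atTop (nhds 0) :=
      tendsto_one_div_add_atTop_nhds_zero_nat
    simpa [δ, div_eq_mul_inv] using h0.const_mul (t - s)
  have hlim : Filter.Tendsto (fun N => ∫ ω in A, M (σ N (N + 1) ω) ω ∂P) Filter.atTop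
      (nhds (∫ ω in A, M (min (t : ℝ≥0∞) (T ω)).toNNReal ω ∂P)) := by
    refine tendsto_integral_of_dominated_convergence (fun _ => K)
      (fun N => (hσm N (N + 1)).aestronglyMeasurable) (integrable_const _)
      (fun N => Filter.Eventually.of_forall fun ω =>
        hK _ ((hσ_le N _ ω).trans (hgt N _ le_rfl)) ω) ?_
    filter_upwards [ae_restrict_mem hA'] with ω hω
    refine ((hc ω).tendsto _).comp ?_
    refine tendsto_of_tendsto_of_tendsto_of_le_of_le tendsto_const_nhds
      (h := fun N => (min (t : ℝ≥0∞) (T ω)).toNNReal + δ N) ?_ (fun N => ?_) (fun N => ?_)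
    · simpa using hδ.const_add (min (t : ℝ≥0∞) (T ω)).toNNReal
    · have := (hbet N (N + 1) ω hω).1
      rwa [hgN] at this
    · have := (hbet N (N + 1) ω hω).2
      rwa [hgN] at this
  refine tendsto_nhds_unique hlim (tendsto_const_nhds.congr fun N => ?_)
  exact (hσi N (N + 1) le_rfl).symm

/-! ### Paths that are continued by other paths -/

section GluePath

/-- The time that has elapsed by time `t` before the time `τ`. -/
noncomputable def elapsed (τ : ℝ≥0∞) (t : ℝ≥0) : ℝ≥0 := (min (t : ℝ≥0∞) τ).toNNReal

lemma elapsed_of_le {τ : ℝ≥0∞} {t : ℝ≥0} (h : (t : ℝ≥0∞) ≤ τ) : elapsed τ t = t := by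
  simp [elapsed, min_eq_left h]

lemma elapsed_of_ge {σ t : ℝ≥0} (h : σ ≤ t) : elapsed σ t = σ := by
  simp [elapsed, min_eq_right (ENNReal.coe_le_coe.2 h)]

lemma elapsed_le (τ : ℝ≥0∞) (t : ℝ≥0) : elapsed τ t ≤ t :=
  ENNReal.toNNReal_mono ENNReal.coe_ne_top (min_le_left _ _)

lemma elapsed_coe (σ t : ℝ≥0) : elapsed σ t = min t σ := by
  rcases le_total t σ with h | h
  · rw [elapsed_of_le (ENNReal.coe_le_coe.2 h), min_eq_left h]
  · rw [elapsed_of_ge h, min_eq_right h]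

lemma elapsed_top (t : ℝ≥0) : elapsed ⊤ t = t := elapsed_of_le le_top

lemma continuous_elapsed (τ : ℝ≥0∞) : Continuous (elapsed τ) := by
  induction τ with
  | top => simpa only [funext elapsed_top] using! continuous_id
  | coe σ => simpa only [funext (elapsed_coe σ)] using! continuous_id.min continuous_const

lemma measurable_elapsed (t : ℝ≥0) : Measurable fun τ => elapsed τ t :=
  (measurable_const.min measurable_id).ennreal_toNNReal

lemma monotone_sub_elapsed (τ : ℝ≥0∞) : Monotone fun t => t - elapsed τ t := by
  intro s t hst
  induction τ with
  | top => simp [elapsed_top]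
  | coe σ =>
    simp only [elapsed_coe]
    rcases le_total s σ with h | h
    · simp [min_eq_left h]
    · rw [min_eq_right h, min_eq_right (h.trans hst)]
      exact tsub_le_tsub_right hst σ

variable {V : Type*} [NormedAddCommGroup V]

/-- The path that follows `w` until time `τ` and has the increments of `w'` thereafter. -/
noncomputable def gluePath (τ : ℝ≥0∞) (w w' : C(ℝ≥0, V)) : C(ℝ≥0, V) where
  toFun t := w (elapsed τ t) + (w' (t - elapsed τ t) - w' 0)
  continuous_toFun := by
    have := continuous_elapsed τ
    fun_prop

lemma gluePath_apply (τ : ℝ≥0∞) (w w' : C(ℝ≥0, V)) (t : ℝ≥0) :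
    gluePath τ w w' t = w (elapsed τ t) + (w' (t - elapsed τ t) - w' 0) := rfl

lemma gluePath_of_le {τ : ℝ≥0∞} (w w' : C(ℝ≥0, V)) {t : ℝ≥0} (h : (t : ℝ≥0∞) ≤ τ) :
    gluePath τ w w' t = w t := by
  simp [gluePath_apply, elapsed_of_le h]

lemma gluePath_add (σ : ℝ≥0) (w w' : C(ℝ≥0, V)) (r : ℝ≥0) :
    gluePath σ w w' (σ + r) = w σ + (w' r - w' 0) := by
  simp [gluePath_apply, elapsed_of_ge (le_self_add : σ ≤ σ + r)]

end GluePath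

/-! ### Solutions continued at a stopping time -/

namespace ControlledDiffusion

namespace BoundedActions

variable {n m : ℕ} {D : ControlledDiffusion n m} (𝒰 : D.BoundedActions)

/-- Only the states have to match at `τ`. The second component enters through its increments alone,
so a mismatch there is a constant that cancels. -/
lemma compensated_gluePath {f : EuclideanSpace ℝ (Fin n) → ℝ}
    (hf : ContDiff ℝ ((⊤ : ℕ∞) : WithTop ℕ∞) f) (hfc : HasCompactSupport f) (τ : ℝ≥0∞)
    {w w' : C(ℝ≥0, EuclideanSpace ℝ (Fin n) × EuclideanSpace ℝ (Fin m))}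
    (h : ∀ σ : ℝ≥0, τ = σ → (w' 0).1 = (w σ).1) (t : ℝ≥0) :
    𝒰.compensated f t (gluePath τ w w') =
      𝒰.compensated f (elapsed τ t) w + 𝒰.compensated f (t - elapsed τ t) w' := by
  by_cases ht : (t : ℝ≥0∞) ≤ τ
  · rw [elapsed_of_le ht, tsub_self, compensated_zero, add_zero]
    exact 𝒰.compensated_congr fun r hr =>
      gluePath_of_le w w' ((ENNReal.coe_le_coe.2 hr).trans ht)
  · rw [not_le] at ht
    lift τ to ℝ≥0 using ht.ne_top
    have hτ : τ ≤ t := ENNReal.coe_le_coe.1 ht.le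
    obtain ⟨b, rfl⟩ := exists_add_of_le hτ
    rw [elapsed_of_ge hτ, add_tsub_cancel_left]
    rw [𝒰.compensated_add hf hfc (w := w') (c := (w τ).2 - (w' 0).2) (fun r => ?_) (fun r => ?_) b]
    · congr 1
      exact 𝒰.compensated_congr fun r hr => gluePath_of_le w w' (ENNReal.coe_le_coe.2 hr)
    · rw [gluePath_add, Prod.fst_add, Prod.fst_sub, h τ rfl]
      abel
    · rw [gluePath_add, Prod.snd_add, Prod.snd_sub]
      abel

lemma measurable_uncurry_compensated {f : EuclideanSpace ℝ (Fin n) → ℝ}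
    (hf : ContDiff ℝ ((⊤ : ℕ∞) : WithTop ℕ∞) f) (hfc : HasCompactSupport f) :
    Measurable fun p : ℝ≥0 × C(ℝ≥0, EuclideanSpace ℝ (Fin n) × EuclideanSpace ℝ (Fin m)) =>
      𝒰.compensated f p.1 p.2 :=
  measurable_uncurry_of_continuous_of_measurable (fun w => 𝒰.continuous_compensated hf hfc w)
    fun t => 𝒰.measurable_compensated' hf t

/-- A solution can be continued, from a stopping time on, by solutions that start at the state
that it has then. -/
lemma IsControlled.glue {𝒰 : D.BoundedActions} {x : EuclideanSpace ℝ (Fin n)} {Ω : Type*}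
    {mΩ : MeasurableSpace Ω} {P : Measure Ω} {F : Filtration ℝ≥0 mΩ}
    {Y : Ω → C(ℝ≥0, EuclideanSpace ℝ (Fin n) × EuclideanSpace ℝ (Fin m))}
    (hY : 𝒰.IsControlled x P F Y) {T : Ω → ℝ≥0∞}
    (hT : ∀ t : ℝ≥0, MeasurableSet[F t] {ω | T ω ≤ t})
    (η : Kernel Ω C(ℝ≥0, EuclideanSpace ℝ (Fin n) × EuclideanSpace ℝ (Fin m)))
    [IsMarkovKernel η] (hη : ∀ ω (σ : ℝ≥0), T ω = σ → 𝒰.IsLaw (Y ω σ).1 (η ω)) :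
    ∃ F' : Filtration ℝ≥0 (mΩ.prod pathMeasurableSpace),
      𝒰.IsControlled x (P ⊗ₘ η) F' fun p => gluePath (T p.1) (Y p.1) p.2 := by
  have := hY.isProbabilityMeasure
  have hYm : Measurable Y := measurable_of_adapted hY.adapted
  have hTm : Measurable T := measurable_of_measurableSet_le F hT
  let active : ℝ≥0 → Set Ω := fun t => {ω | T ω ≤ t}
  have hactive : Monotone active := fun s t hst ω hω =>
    le_trans hω (ENNReal.coe_le_coe.2 hst)
  let age : ℝ≥0 → Ω → ℝ≥0 := fun t ω => t - elapsed (T ω) t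
  have hage : ∀ ω, Monotone fun t => age t ω := fun ω => monotone_sub_elapsed (T ω)
  let F' := gluedFiltration F
    (pathFiltration (EuclideanSpace ℝ (Fin n) × EuclideanSpace ℝ (Fin m))) active age hactive hage
  have hem : ∀ t, Measurable fun ω => elapsed (T ω) t := fun t => (measurable_elapsed t).comp hTm
  have hgm : ∀ t, Measurable fun
      p : Ω × C(ℝ≥0, EuclideanSpace ℝ (Fin n) × EuclideanSpace ℝ (Fin m)) =>
        gluePath (T p.1) (Y p.1) p.2 t := by
    intro t
    simp only [gluePath_apply]
    have h1 := measurable_path_eval_uncurry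
      (V := EuclideanSpace ℝ (Fin n) × EuclideanSpace ℝ (Fin m))
    have h2 := h1.comp (((hem t).comp measurable_fst).prodMk (hYm.comp measurable_fst)
      : Measurable fun p : Ω × C(ℝ≥0, EuclideanSpace ℝ (Fin n) × EuclideanSpace ℝ (Fin m)) =>
        (elapsed (T p.1) t, Y p.1))
    have h3 := h1.comp ((measurable_const.sub ((hem t).comp measurable_fst)).prodMk measurable_snd
      : Measurable fun p : Ω × C(ℝ≥0, EuclideanSpace ℝ (Fin n) × EuclideanSpace ℝ (Fin m)) =>
        (t - elapsed (T p.1) t, p.2))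
    have h4 := h1.comp (measurable_const.prodMk measurable_snd
      : Measurable fun p : Ω × C(ℝ≥0, EuclideanSpace ℝ (Fin n) × EuclideanSpace ℝ (Fin m)) =>
        ((0 : ℝ≥0), p.2))
    exact h2.add (h3.sub h4)
  have hgm' := measurable_path_iff.2 hgm
  have hadapted : ∀ t, Measurable[F' t] fun
      p : Ω × C(ℝ≥0, EuclideanSpace ℝ (Fin n) × EuclideanSpace ℝ (Fin m)) =>
        gluePath (T p.1) (Y p.1) p.2 t := by
    intro t
    refine measurable_gluedFiltration (hgm t) (fun ω _ => ?_) (hY.adapted t) fun ω hω w => ?_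
    · simp only [gluePath_apply]
      exact ((measurable_pathFiltration_eval le_rfl).sub
        (measurable_pathFiltration_eval zero_le)).const_add _
    · exact gluePath_of_le _ _ (le_of_lt (not_le.1 hω))
  have hstart : ∀ᵐ p ∂(P ⊗ₘ η), T p.1 = ⊤ ∨ (p.2 0).1 = (Y p.1 (T p.1).toNNReal).1 := by
    have h1 := measurable_path_eval_uncurry
      (V := EuclideanSpace ℝ (Fin n) × EuclideanSpace ℝ (Fin m))
    refine Measure.ae_compProd_of_ae_ae (MeasurableSet.union
      ((hTm.comp measurable_fst) (measurableSet_singleton ⊤)) (measurableSet_eq_fun ?_ ?_)) ?_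
    · exact ((continuous_eval_const (0 : ℝ≥0)).measurable.comp measurable_snd).fst
    · exact (h1.comp ((hTm.ennreal_toNNReal.comp measurable_fst).prodMk
        (hYm.comp measurable_fst))).fst
    · refine Filter.Eventually.of_forall fun ω => ?_
      by_cases h : T ω = ⊤
      · exact Filter.Eventually.of_forall fun w => Or.inl h
      · filter_upwards [(hη ω _ (ENNReal.coe_toNNReal h).symm).initial] with w hw
        exact Or.inr hw
  refine ⟨F', inferInstance, hadapted, ?_, ?_, fun f hf hfc s t hst A hA => ?_⟩
  · refine Measure.ae_compProd_of_ae_ae ((hgm 0).fst (measurableSet_singleton x)) ?_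
    filter_upwards [hY.initial] with ω hω
    refine Filter.Eventually.of_forall fun w => ?_
    rw [gluePath_of_le _ _ zero_le, hω]
  · refine Measure.ae_compProd_of_ae_ae (hgm' (measurableSet_absorbedPaths (D := D))) ?_
    filter_upwards [hY.absorbed] with ω hω
    rcases eq_or_ne (T ω) ⊤ with h | h
    · refine Filter.Eventually.of_forall fun w => ?_
      intro s t hst
      rw [h, gluePath_of_le _ _ le_top, gluePath_of_le _ _ le_top]
      exact hω s t hst
    · obtain ⟨σ, hσ⟩ : ∃ σ : ℝ≥0, T ω = σ := ⟨_, (ENNReal.coe_toNNReal h).symm⟩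
      filter_upwards [(hη ω σ hσ).initial, (hη ω σ hσ).absorbed] with w hw₀ hw s t hst hs
      simp only [hσ, id] at hs hw hw₀ ⊢
      have hadd : ∀ r, (gluePath σ (Y ω) w (σ + r)).1 = (w r).1 := by
        intro r
        rw [gluePath_add, Prod.fst_add, Prod.fst_sub, hw₀]
        abel
      have hle : ∀ r ≤ σ, gluePath σ (Y ω) w r = Y ω r := fun r hr =>
        gluePath_of_le _ _ (ENNReal.coe_le_coe.2 hr)
      rcases le_total t σ with ht | ht
      · rw [hle t ht, hle s (hst.trans ht)]
        rw [hle s (hst.trans ht)] at hs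
        exact hω s t hst hs
      · obtain ⟨t, rfl⟩ := exists_add_of_le ht
        rcases le_total s σ with hs' | hs'
        -- A path frozen before `σ` is still in its terminal state at `σ`, so the continuation
        -- starts there and stays.
        · rw [hle s hs'] at hs ⊢
          have h1 := hω s σ hs' hs
          rw [hadd, ← h1, ← hw₀]
          refine hw 0 t zero_le ?_
          rwa [hw₀, h1]
        · obtain ⟨s, rfl⟩ := exists_add_of_le hs'
          rw [hadd] at hs
          rw [hadd, hadd]
          exact hw s t (le_of_add_le_add_left hst) hs
  · have hAm : MeasurableSet A := hA.1
    obtain ⟨-, hAsec, A₁, hA₁, hAA₁⟩ := hA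
    obtain ⟨K, hK⟩ := 𝒰.exists_compensated_le hf hfc t
    have hcm := 𝒰.measurable_uncurry_compensated hf hfc
    -- `N` is the functional of the old path stopped at `T`, and `L` that of the new path at its own
    -- age.
    let N : ℝ≥0 → Ω → ℝ := fun r ω => 𝒰.compensated f (elapsed (T ω) r) (Y ω)
    let L : ℝ≥0 → Ω × C(ℝ≥0, EuclideanSpace ℝ (Fin n) × EuclideanSpace ℝ (Fin m)) → ℝ :=
      fun r p => 𝒰.compensated f (age r p.1) p.2
    have hNm : ∀ r, Measurable (N r) := fun r => hcm.comp ((hem r).prodMk hYm)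
    have hLm : ∀ r, Measurable (L r) := fun r => hcm.comp
      ((measurable_const.sub ((hem r).comp measurable_fst)).prodMk measurable_snd)
    have hNK : ∀ r ≤ t, ∀ ω, ‖N r ω‖ ≤ K := fun r hr ω => hK _ ((elapsed_le _ _).trans hr) _
    have hLK : ∀ r ≤ t, ∀ p, ‖L r p‖ ≤ K := fun r hr p => hK _ (tsub_le_self.trans hr) _
    have hNi : ∀ r ≤ t, ∀ B, Integrable (fun
        p : Ω × C(ℝ≥0, EuclideanSpace ℝ (Fin n) × EuclideanSpace ℝ (Fin m)) => N r p.1)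
        ((P ⊗ₘ η).restrict B) := fun r hr B =>
      Integrable.of_bound ((hNm r).comp measurable_fst).aestronglyMeasurable K
        (Filter.Eventually.of_forall fun p => hNK r hr p.1)
    have hLi : ∀ r ≤ t, ∀ B, Integrable (L r) ((P ⊗ₘ η).restrict B) := fun r hr B =>
      Integrable.of_bound (hLm r).aestronglyMeasurable K
        (Filter.Eventually.of_forall fun p => hLK r hr p)
    have hsplit : ∀ r ≤ t, ∫ p in A, 𝒰.compensated f r (gluePath (T p.1) (Y p.1) p.2) ∂(P ⊗ₘ η)
        = ∫ p in A, N r p.1 ∂(P ⊗ₘ η) + ∫ p in A, L r p ∂(P ⊗ₘ η) := by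
      intro r hr
      rw [← integral_add (hNi r hr A) (hLi r hr A)]
      refine setIntegral_congr_ae hAm ?_
      filter_upwards [hstart] with p hp _
      refine 𝒰.compensated_gluePath hf hfc (T p.1) (fun σ hσ => ?_) r
      rcases hp with hp | hp
      · rw [hσ] at hp
        exact absurd hp ENNReal.coe_ne_top
      · rwa [hσ, ENNReal.toNNReal_coe] at hp
    -- Fibrewise: before `T` both ages are zero; after it, the section of `A` is known at age `age s
    -- ω` and `η ω` solves the martingale problem.
    have hL : ∫ p in A, L t p ∂(P ⊗ₘ η) = ∫ p in A, L s p ∂(P ⊗ₘ η) := by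
      rw [← sub_eq_zero, ← integral_sub (hLi t le_rfl A) (hLi s hst A), ← integral_indicator hAm,
        Measure.integral_compProd]
      swap
      · rw [integrable_indicator_iff hAm]
        exact (hLi t le_rfl A).sub (hLi s hst A)
      refine integral_eq_zero_of_ae (Filter.Eventually.of_forall fun ω => ?_)
      have hAω : MeasurableSet (Prod.mk ω ⁻¹' A) := measurable_prodMk_left hAm
      have e1 : (fun w => A.indicator (fun p => L t p - L s p) (ω, w)) =
          (Prod.mk ω ⁻¹' A).indicator fun w =>
            𝒰.compensated f (age t ω) w - 𝒰.compensated f (age s ω) w := rfl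
      simp only [e1, integral_indicator hAω, Pi.zero_apply]
      by_cases htT : (t : ℝ≥0∞) ≤ T ω
      · have hsT : (s : ℝ≥0∞) ≤ T ω := (ENNReal.coe_le_coe.2 hst).trans htT
        simp [age, elapsed_of_le htT, elapsed_of_le hsT]
      · rw [not_le] at htT
        have hlaw := hη ω _ (ENNReal.coe_toNNReal htT.ne_top).symm
        have hprob := hlaw.isProbabilityMeasure
        have hci : ∀ r ≤ t, Integrable (𝒰.compensated f r)
            ((η ω).restrict (Prod.mk ω ⁻¹' A)) := fun r hr =>
          Integrable.of_bound (𝒰.measurable_compensated' hf r).aestronglyMeasurable K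
            (Filter.Eventually.of_forall fun w => hK r hr w)
        rw [integral_sub (hci _ tsub_le_self) (hci _ (tsub_le_self.trans hst)), sub_eq_zero]
        refine hlaw.hasMartingale f hf hfc (age s ω) (age t ω) (hage ω hst) _ ?_
        by_cases hs : ω ∈ active s
        · exact hAsec ω hs
        · by_cases hω : ω ∈ A₁
          · convert MeasurableSet.univ
            ext w
            simp [hAA₁ ω hs w, hω]
          · convert MeasurableSet.empty
            ext w
            simp [hAA₁ ω hs w, hω]
    -- Where `T ≤ s` the stopped functional no longer changes. Elsewhere `A` depends only on `ω`,
    -- through an event of `F s`, and optional stopping applies.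
    have hN : ∫ p in A, N t p.1 ∂(P ⊗ₘ η) = ∫ p in A, N s p.1 ∂(P ⊗ₘ η) := by
      rw [← sub_eq_zero, ← integral_sub (hNi t le_rfl A) (hNi s hst A), ← integral_indicator hAm,
        Measure.integral_compProd]
      swap
      · rw [integrable_indicator_iff hAm]
        exact (hNi t le_rfl A).sub (hNi s hst A)
      have hB : MeasurableSet[F s] (A₁ ∩ (active s)ᶜ) := hA₁.inter (hT s).compl
      have e1 : ∀ ω w, A.indicator (fun p => N t p.1 - N s p.1) (ω, w) =
          (A₁ ∩ (active s)ᶜ).indicator (fun ω => N t ω - N s ω) ω := by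
        intro ω w
        by_cases hs : ω ∈ active s
        · have h1 : N t ω - N s ω = 0 := by
            have hs' : T ω ≤ s := hs
            have hsT : T ω ≤ t := hs'.trans (ENNReal.coe_le_coe.2 hst)
            simp only [N, elapsed, min_eq_right hs', min_eq_right hsT, sub_self]
          rw [Set.indicator_of_notMem (show ω ∉ A₁ ∩ (active s)ᶜ from fun h => h.2 hs)]
          by_cases hω : (ω, w) ∈ A
          · rw [Set.indicator_of_mem hω, h1]
          · rw [Set.indicator_of_notMem hω]
        · by_cases hω : ω ∈ A₁
          · rw [Set.indicator_of_mem ((hAA₁ ω hs w).2 hω), Set.indicator_of_mem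
              (show ω ∈ A₁ ∩ (active s)ᶜ from ⟨hω, hs⟩)]
          · rw [Set.indicator_of_notMem (fun h => hω ((hAA₁ ω hs w).1 h)),
              Set.indicator_of_notMem (show ω ∉ A₁ ∩ (active s)ᶜ from fun h => hω h.1)]
      simp only [e1, integral_const, probReal_univ, one_smul]
      have hNi' : ∀ r ≤ t, Integrable (N r) (P.restrict (A₁ ∩ (active s)ᶜ)) := fun r hr =>
        Integrable.of_bound (hNm r).aestronglyMeasurable K
          (Filter.Eventually.of_forall fun ω => hNK r hr ω)
      rw [integral_indicator (F.le s _ hB), integral_sub (hNi' t le_rfl) (hNi' s hst), sub_eq_zero]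
      have h1 := setIntegral_stopped_eq (P := P) (F := F)
        (M := fun r ω => 𝒰.compensated f r (Y ω))
        (fun r => (𝒰.measurable_compensated' hf r).comp hYm)
        (fun ω => 𝒰.continuous_compensated hf hfc (Y ω)) (fun r hr ω => hK r hr (Y ω))
        (hY.hasMartingale f hf hfc) hT hst hB fun ω hω => not_le.1 hω.2
      refine h1.trans (setIntegral_congr_fun (F.le s _ hB) fun ω hω => ?_)
      simp only [N, elapsed_of_le (le_of_lt (not_le.1 hω.2))]
    rw [hsplit t le_rfl, hsplit s hst, hL, hN]

end BoundedActions

end ControlledDiffusion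

namespace ControlledDiffusion

variable {n m : ℕ} {D : ControlledDiffusion n m}

/-! ### Future courses and the laws of paths -/

lemma stronglyMeasurable_comp_prodMap {T Ω W V : Type*} [MeasurableSpace T]
    {mΩ : MeasurableSpace Ω} {mW : MeasurableSpace W} [TopologicalSpace V] {g : T × W → V}
    (hg : StronglyMeasurable g) {Y : Ω → W} (hY : Measurable Y) :
    StronglyMeasurable fun p : T × Ω => g (p.1, Y p.2) :=
  hg.comp_measurable (measurable_fst.prodMk (hY.comp measurable_snd))

lemma BoundedActions.isStronglyProgressive_action_comp (𝒰 : D.BoundedActions) {Ω : Type*}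
    {mΩ : MeasurableSpace Ω} {F : Filtration ℝ≥0 mΩ}
    {Y : Ω → C(ℝ≥0, EuclideanSpace ℝ (Fin n) × EuclideanSpace ℝ (Fin m))}
    (hY : ∀ t, Measurable[F t] fun ω => Y ω t) :
    IsStronglyProgressive F fun t ω => 𝒰.action (Y ω) t := fun t =>
  stronglyMeasurable_comp_prodMap (mΩ := F t) (mW := pathFiltration _ t)
    (𝒰.isStronglyProgressive_action t) (measurable_path_of_adapted F hY t)

/-- A solution that is controlled by the increments of a path is a future course. -/
noncomputable def BoundedActions.IsControlled.toCourse {𝒰 : D.BoundedActions}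
    {x : EuclideanSpace ℝ (Fin n)} {Ω : Type} {mΩ : MeasurableSpace Ω} {P : Measure Ω}
    {F : Filtration ℝ≥0 mΩ}
    {Y : Ω → C(ℝ≥0, EuclideanSpace ℝ (Fin n) × EuclideanSpace ℝ (Fin m))}
    (hY : 𝒰.IsControlled x P F Y) : D.Course x P where
  isProbabilityMeasure := hY.isProbabilityMeasure
  filtration := F
  u t ω := 𝒰.action (Y ω) t
  X t ω := (Y ω t).1
  progressive_u := 𝒰.isStronglyProgressive_action_comp hY.adapted
  u_mem t ω := 𝒰.subset (𝒰.action_mem _ t)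
  u_bounded := ⟨𝒰.bound, fun t ω => 𝒰.norm_action_le _ t⟩
  adapted_X t := (hY.adapted t).fst.stronglyMeasurable
  continuous_X ω := (Y ω).continuous.fst
  initial := hY.initial
  absorbed := hY.absorbed
  martingale f hf hfc := by
    have := hY.isProbabilityMeasure
    have hm : ∀ t, Measurable[F t] fun ω => 𝒰.compensated f t (Y ω) :=
      𝒰.measurable_compensated_comp hY.adapted hf
    have hint : ∀ t, Integrable (fun ω => 𝒰.compensated f t (Y ω)) P := by
      intro t
      obtain ⟨K, hK⟩ := 𝒰.exists_compensated_le hf hfc t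
      exact Integrable.of_bound ((hm t).mono (F.le t) le_rfl).aestronglyMeasurable K
        (Filter.Eventually.of_forall fun ω => hK t le_rfl _)
    refine ⟨fun t => (hm t).stronglyMeasurable, fun s t hst => ?_⟩
    exact (ae_eq_condExp_of_forall_setIntegral_eq (F.le s) (hint t)
      (fun A _ _ => (hint s).integrableOn)
      (fun A hA _ => (hY.hasMartingale f hf hfc s t hst A hA).symm)
      (hm s).aestronglyMeasurable).symm

/-- The actions can be recovered from the path of their integral. -/
lemma ae_tendsto_diffQuot {g : ℝ≥0 → EuclideanSpace ℝ (Fin m)} {t : ℝ≥0}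
    (hg : IntervalIntegrable (fun r : ℝ => g r.toNNReal) volume 0 t)
    {w : C(ℝ≥0, EuclideanSpace ℝ (Fin n) × EuclideanSpace ℝ (Fin m))}
    (hw : ∀ s : ℝ≥0, (w s).2 = ∫ r in (0 : ℝ)..s, g r.toNNReal) :
    ∀ᵐ r : ℝ, r ∈ Set.uIoc (0 : ℝ) t →
      Filter.Tendsto (diffQuot w r.toNNReal) Filter.atTop (nhds (g r.toNNReal)) := by
  -- Lebesgue differentiation, used along the negative steps `-1 / (k + 1)`.
  filter_upwards [hg.ae_hasDerivAt_integral] with r hr hrt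
  have h1 := hr (Set.uIoc_subset_uIcc hrt) 0 Set.left_mem_uIcc
  rw [Set.uIoc_of_le t.coe_nonneg] at hrt
  rw [hasDerivAt_iff_tendsto_slope_zero] at h1
  have h0 : Filter.Tendsto (fun k : ℕ => 1 / ((k : ℝ) + 1)) Filter.atTop (nhds 0) :=
    tendsto_one_div_add_atTop_nhds_zero_nat
  have h2 : Filter.Tendsto (fun k : ℕ => -(1 / ((k : ℝ) + 1))) Filter.atTop
      (nhdsWithin 0 {0}ᶜ) := by
    refine tendsto_nhdsWithin_iff.2 ⟨by simpa using h0.neg,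
      Filter.Eventually.of_forall fun k => ?_⟩
    have : (k : ℝ) + 1 ≠ 0 := by positivity
    simpa using this
  refine (h1.comp h2).congr' ?_
  -- Once the step is shorter than `r`, the truncated subtraction in `diffQuot` is the true one.
  filter_upwards [h0.eventually (gt_mem_nhds hrt.1)] with k hk
  have h3 : (r.toNNReal - 1 / ((k : ℝ≥0) + 1) : ℝ≥0) = r + -(1 / ((k : ℝ) + 1)) := by
    rw [NNReal.coe_sub, Real.coe_toNNReal _ hrt.1.le]
    · push_cast
      ring
    · rw [← NNReal.coe_le_coe, Real.coe_toNNReal _ hrt.1.le]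
      push_cast
      exact hk.le
  simp only [Function.comp, diffQuot, hw, h3, Real.coe_toNNReal _ hrt.1.le]
  rw [inv_neg, one_div, inv_inv, neg_smul, ← smul_neg, neg_sub]

/-- The integral of the actions is taken as second component. Its left derivative is the action at
almost every time, so the functional of the martingale problem is unchanged. -/
lemma Course.exists_isControlled {x : EuclideanSpace ℝ (Fin n)} {Ω : Type}
    [MeasurableSpace Ω] {P : Measure Ω} (S : D.Course x P) (𝒰 : D.BoundedActions)
    (hu : ∀ t ω, S.u t ω ∈ 𝒰.set) :
    ∃ Y : Ω → C(ℝ≥0, EuclideanSpace ℝ (Fin n) × EuclideanSpace ℝ (Fin m)),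
      (∀ ω t, (Y ω t).1 = S.X t ω) ∧ 𝒰.IsControlled x P S.filtration Y := by
  have := S.isProbabilityMeasure
  have hint : ∀ ω (t : ℝ≥0),
      IntervalIntegrable (fun r : ℝ => S.u r.toNNReal ω) volume 0 t := fun ω t =>
    intervalIntegrable_of_progressive (S.progressive_u t) (fun r ω => 𝒰.norm_le _ (hu r ω)) ω
  let Y : Ω → C(ℝ≥0, EuclideanSpace ℝ (Fin n) × EuclideanSpace ℝ (Fin m)) := fun ω =>
    ⟨fun t => (S.X t ω, ∫ r in (0 : ℝ)..t, S.u r.toNNReal ω),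
      (S.continuous_X ω).prodMk (continuous_integral_of_forall (g := fun t => S.u t ω) (hint ω))⟩
  have hcomp : ∀ f t ω, 𝒰.compensated f t (Y ω) = f (S.X t ω) - f (S.X 0 ω) -
      ∫ r in (0 : ℝ)..(t : ℝ),
        D.terminalᶜ.indicator (D.generator (S.u r.toNNReal ω) f) (S.X r.toNNReal ω) := by
    intro f t ω
    rw [BoundedActions.compensated]
    congr 1
    refine intervalIntegral.integral_congr_ae ?_
    filter_upwards [ae_tendsto_diffQuot (g := fun t => S.u t ω) (hint ω t) (w := Y ω)
      fun _ => rfl] with r hr hrt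
    rw [𝒰.action_eq_of_tendsto (hr hrt) (hu _ _)]
    rfl
  refine ⟨Y, fun ω t => rfl, S.isProbabilityMeasure, fun t => ?_, S.initial, S.absorbed,
    fun f hf hfc s t hst A hA => ?_⟩
  · exact (S.adapted_X t).measurable.prodMk
      (stronglyMeasurable_integral_of_progressive (S.progressive_u t)).measurable
  · simp only [hcomp]
    exact ((S.martingale f hf hfc).setIntegral_eq hst hA).symm

lemma BoundedActions.IsControlled.isLaw {𝒰 : D.BoundedActions} {x : EuclideanSpace ℝ (Fin n)}
    {Ω : Type*} {mΩ : MeasurableSpace Ω} {P : Measure Ω} {F : Filtration ℝ≥0 mΩ}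
    {Y : Ω → C(ℝ≥0, EuclideanSpace ℝ (Fin n) × EuclideanSpace ℝ (Fin m))}
    (hY : 𝒰.IsControlled x P F Y) : 𝒰.IsLaw x (P.map Y) := by
  have := hY.isProbabilityMeasure
  have hm : Measurable Y := measurable_of_adapted hY.adapted
  refine ⟨Measure.isProbabilityMeasure_map hm.aemeasurable,
    fun t => measurable_pathFiltration_eval le_rfl, ?_, ?_, fun f hf hfc s t hst A hA => ?_⟩
  · rw [ae_map_iff hm.aemeasurable]
    · exact hY.initial
    · exact (continuous_eval_const (0 : ℝ≥0)).measurable.fst (measurableSet_singleton x)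
  · rw [ae_map_iff hm.aemeasurable]
    · exact hY.absorbed
    · exact BoundedActions.measurableSet_absorbedPaths
  · have hA' := (pathFiltration _).le s A hA
    have h1 : ∀ r, ∫ w in A, 𝒰.compensated f r (id w) ∂(P.map Y) =
        ∫ ω in Y ⁻¹' A, 𝒰.compensated f r (Y ω) ∂P := fun r =>
      setIntegral_map hA' (𝒰.measurable_compensated' hf r).aestronglyMeasurable hm.aemeasurable
    rw [h1, h1]
    exact hY.hasMartingale f hf hfc s t hst _ (measurable_path_of_adapted F hY.adapted s hA)

/-! ### Reaching a set of terminal states -/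

/-- The set of paths whose state is in `B` at a time of the form `min k τ`. For paths that are
frozen in `B` this means that they reach `B` by time `τ`. -/
def reachingPaths (m : ℕ) (B : Set (EuclideanSpace ℝ (Fin n))) (τ : ℝ≥0∞) :
    Set C(ℝ≥0, EuclideanSpace ℝ (Fin n) × EuclideanSpace ℝ (Fin m)) :=
  {w | ∃ k : ℕ, (w (elapsed τ k)).1 ∈ B}

lemma measurableSet_reachingPaths {B : Set (EuclideanSpace ℝ (Fin n))} (hB : MeasurableSet B) :
    MeasurableSet {p : ℝ≥0∞ × C(ℝ≥0, EuclideanSpace ℝ (Fin n) × EuclideanSpace ℝ (Fin m)) |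
      p.2 ∈ reachingPaths m B p.1} := by
  have h : {p : ℝ≥0∞ × C(ℝ≥0, EuclideanSpace ℝ (Fin n) × EuclideanSpace ℝ (Fin m)) |
      p.2 ∈ reachingPaths m B p.1} = ⋃ k : ℕ, {p | (p.2 (elapsed p.1 k)).1 ∈ B} := by
    ext p
    simp [reachingPaths]
  rw [h]
  refine MeasurableSet.iUnion fun k => ?_
  have h1 := (measurable_path_eval_uncurry
    (V := EuclideanSpace ℝ (Fin n) × EuclideanSpace ℝ (Fin m))).comp
      (((measurable_elapsed k).comp measurable_fst).prodMk measurable_snd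
    : Measurable fun p : ℝ≥0∞ × C(ℝ≥0, EuclideanSpace ℝ (Fin n) × EuclideanSpace ℝ (Fin m)) =>
        (elapsed p.1 k, p.2))
  exact h1.fst hB

/-- A path that is in `B` at time `t` is frozen there, hence still in `B` at the later sampled time
`min k τ` with `t ≤ k`. Countably many samples therefore suffice. -/
lemma mem_reachingPaths {B : Set (EuclideanSpace ℝ (Fin n))} (hBF : B ⊆ D.terminal)
    {w : C(ℝ≥0, EuclideanSpace ℝ (Fin n) × EuclideanSpace ℝ (Fin m))}
    (hw : w ∈ BoundedActions.absorbedPaths D) {τ : ℝ≥0∞} {t : ℝ≥0}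
    (ht : (t : ℝ≥0∞) ≤ τ) (htB : (w t).1 ∈ B) :
    w ∈ reachingPaths m B τ := by
  obtain ⟨k, hk⟩ := exists_nat_ge t
  refine ⟨k, ?_⟩
  rw [hw t _ ?_ (hBF htB)]
  · exact htB
  · rw [elapsed, ← ENNReal.coe_le_coe, ENNReal.coe_toNNReal
      (ne_top_of_le_ne_top ENNReal.coe_ne_top (min_le_left _ _))]
    exact le_min (ENNReal.coe_le_coe.2 hk) ht

lemma exists_of_mem_reachingPaths {B : Set (EuclideanSpace ℝ (Fin n))} {τ : ℝ≥0∞}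
    {w : C(ℝ≥0, EuclideanSpace ℝ (Fin n) × EuclideanSpace ℝ (Fin m))}
    (hw : w ∈ reachingPaths m B τ) : ∃ t : ℝ≥0, (t : ℝ≥0∞) ≤ τ ∧ (w t).1 ∈ B := by
  obtain ⟨k, hk⟩ := hw
  exact ⟨_, ENNReal.coe_toNNReal_le_self.trans (min_le_right _ _), hk⟩

lemma Course.measure_reachingPaths_ne_zero {B : Set (EuclideanSpace ℝ (Fin n))}
    (hB : MeasurableSet B) (hBF : B ⊆ D.terminal) {x : EuclideanSpace ℝ (Fin n)} {Ω : Type}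
    [MeasurableSpace Ω] {P : Measure Ω} (S : D.Course x P) {τ : ℝ≥0∞} (h : P (S.occurs B τ) ≠ 0)
    {Y : Ω → C(ℝ≥0, EuclideanSpace ℝ (Fin n) × EuclideanSpace ℝ (Fin m))}
    (hYX : ∀ ω t, (Y ω t).1 = S.X t ω) (hY : Measurable Y) :
    P.map Y (reachingPaths m B τ) ≠ 0 := by
  have hm : MeasurableSet (reachingPaths m B τ) :=
    measurable_prodMk_left (measurableSet_reachingPaths hB)
  rw [Measure.map_apply hY hm]
  intro h0
  refine h (measure_mono_null_ae ?_ h0)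
  filter_upwards [S.absorbed] with ω hω
  rintro ⟨t, ht, htB⟩
  refine mem_reachingPaths hBF (fun s t hst hs => ?_) ht (by rwa [hYX])
  rw [hYX] at hs ⊢
  rw [hYX]
  exact hω s t hst hs

/-! ### The reachability remains zero -/

/-- A failure at some time is turned into a stopping time with a selected continuation, and the
glued solution is a course from `x` that reaches `B` with positive probability. -/
theorem reachability_remains_zero {B : Set (EuclideanSpace ℝ (Fin n))}
    (hB : MeasurableSet B) (hBF : B ⊆ D.terminal) {h : ℝ≥0∞} {x : EuclideanSpace ℝ (Fin n)}
    (hx : D.reachability B h x = 0) {Ω : Type} [mΩ : MeasurableSpace Ω] {P : Measure Ω}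
    (S : D.Course x P) :
    ∀ᵐ ω ∂P, ∀ t : ℝ≥0, (t : ℝ≥0∞) ≤ h → D.reachability B (h - t) (S.X t ω) = 0 := by
  have := S.isProbabilityMeasure
  by_contra hcon
  obtain ⟨κ, hκ, hκs⟩ := exists_kernel_attaining
    C(ℝ≥0, EuclideanSpace ℝ (Fin n) × EuclideanSpace ℝ (Fin m))
  obtain ⟨C₀, hC₀⟩ := S.u_bounded
  obtain ⟨ω₀⟩ : Nonempty Ω := nonempty_of_isProbabilityMeasure P
  let 𝒰 : ℕ → D.BoundedActions := fun C =>
    { set := D.actions ∩ Metric.closedBall 0 (max C₀ C)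
      default := S.u 0 ω₀
      bound := max C₀ C
      measurableSet := D.measurableSet_actions.inter Metric.isClosed_closedBall.measurableSet
      subset := Set.inter_subset_left
      default_mem := ⟨S.u_mem _ _, by simpa using Or.inl (hC₀ 0 ω₀)⟩
      norm_le := fun u hu => by simpa using hu.2 }
  -- The condition on the clock excludes times after `h`, where the truncated difference `h - t`
  -- would be zero and not the time left.
  let G : ℕ → Set ((ℝ≥0 × EuclideanSpace ℝ (Fin n)) × (ℚ → ℝ)) := fun C =>
    {p | (p.1.1 : ℝ≥0∞) ≤ h ∧ (𝒰 C).IsLaw p.1.2 (κ p.2) ∧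
      κ p.2 (reachingPaths m B (h - p.1.1)) ≠ 0}
  have hG : ∀ C, MeasurableSet (G C) := by
    intro C
    refine MeasurableSet.inter (measurable_fst.fst.coe_nnreal_ennreal measurableSet_Iic)
      (MeasurableSet.inter ((measurable_fst.snd.prodMk measurable_snd)
        ((𝒰 C).measurableSet_isLaw κ)) ?_)
    have h1 : MeasurableSet {q : ((ℝ≥0 × EuclideanSpace ℝ (Fin n)) × (ℚ → ℝ)) ×
        C(ℝ≥0, EuclideanSpace ℝ (Fin n) × EuclideanSpace ℝ (Fin m)) |
          q.2 ∈ reachingPaths m B (h - q.1.1.1)} :=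
      ((measurable_const.sub measurable_fst.fst.fst.coe_nnreal_ennreal).prodMk measurable_snd)
        (measurableSet_reachingPaths hB)
    exact ((Kernel.measurable_kernel_prodMk_left (κ := κ.comap Prod.snd measurable_snd) h1)
      (measurableSet_singleton 0)).compl
  -- Each witness has bounded actions, so the exceptional set is covered by countably many sets, one
  -- for each `C`, and they cannot all be null.
  obtain ⟨C, hC⟩ : ∃ C, P {ω | ∃ t z, ((t, S.X t ω), z) ∈ G C} ≠ 0 := by
    by_contra! hall
    refine hcon (measure_mono_null ?_ (measure_iUnion_null hall))
    intro ω hω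
    have hω' : ¬ ∀ t : ℝ≥0, (t : ℝ≥0∞) ≤ h → D.reachability B (h - t) (S.X t ω) = 0 := hω
    simp only [reachability, ENNReal.iSup_eq_zero, not_forall] at hω'
    obtain ⟨t, ht, Ω', mΩ', P', S', hS'⟩ := hω'
    obtain ⟨C', hC'⟩ := S'.u_bounded
    obtain ⟨C, hC⟩ := exists_nat_ge C'
    obtain ⟨Y, hYX, hY⟩ := S'.exists_isControlled (𝒰 C) fun r ω' => ⟨S'.u_mem _ _, by
      simpa using Or.inr ((hC' r ω').trans hC)⟩
    obtain ⟨z, hz⟩ := hκs _ hY.isLaw.isProbabilityMeasure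
    refine Set.mem_iUnion.2 ⟨C, t, z, ht, ?_, ?_⟩
    · simp only [hz]
      exact hY.isLaw
    · simp only [hz]
      exact S'.measure_reachingPaths_ne_zero hB hBF hS' hYX
        (BoundedActions.measurable_of_adapted hY.adapted)
  obtain ⟨Y, hYX, hY⟩ := S.exists_isControlled (𝒰 C) fun r ω => ⟨S.u_mem _ _, by
    simpa using Or.inl (hC₀ r ω)⟩
  have hXm : ∀ t, Measurable[S.filtration t] (S.X t) := fun t => (S.adapted_X t).measurable
  obtain ⟨T, g, hg, hT, hTpos, hgG⟩ := exists_stopping_selection S.filtration hXm S.continuous_X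
    (hG C) hC
  have hTm : Measurable T := measurable_of_measurableSet_le S.filtration hT
  have hXT : Measurable fun ω => S.X (T ω).toNNReal ω := by
    have h1 := (measurable_path_eval_uncurry
      (V := EuclideanSpace ℝ (Fin n) × EuclideanSpace ℝ (Fin m))).comp
        (hTm.ennreal_toNNReal.prodMk (BoundedActions.measurable_of_adapted hY.adapted))
    simpa only [Function.comp_def, hYX] using h1.fst
  have hGω : ∀ ω ∈ {ω | T ω ≠ ⊤},
      (((T ω).toNNReal, S.X (T ω).toNNReal ω), g ((T ω).toNNReal, S.X (T ω).toNNReal ω)) ∈ G C :=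
    fun ω hω => hgG ω _ (ENNReal.coe_toNNReal hω).symm
  obtain ⟨η, hη, hηH⟩ := exists_markovKernel_eqOn κ (H := {ω | T ω ≠ ⊤})
    (hTm (measurableSet_singleton ⊤)).compl
    (g := fun ω => g ((T ω).toNNReal, S.X (T ω).toNNReal ω))
    (hg.comp (hTm.ennreal_toNNReal.prodMk hXT)) fun ω hω => (hGω ω hω).2.1.isProbabilityMeasure
  have hηlaw : ∀ ω (σ : ℝ≥0), T ω = σ → (𝒰 C).IsLaw (Y ω σ).1 (η ω) := by
    intro ω σ hσ
    have hω : T ω ≠ ⊤ := hσ ▸ ENNReal.coe_ne_top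
    have h1 := (hGω ω hω).2.1
    rw [hηH ω hω, hYX]
    simpa only [hσ, ENNReal.toNNReal_coe] using h1
  obtain ⟨F', hF'⟩ := hY.glue hT η hηlaw
  have hpos : (P ⊗ₘ η) (hF'.toCourse.occurs B h) ≠ 0 := by
    refine compProd_ne_zero hTpos fun ω hω h0 => ?_
    obtain ⟨hTh, -, hreach⟩ := hGω ω hω
    obtain ⟨σ, hσ⟩ : ∃ σ : ℝ≥0, T ω = σ := ⟨_, (ENNReal.coe_toNNReal hω).symm⟩
    simp only [hσ, ENNReal.toNNReal_coe] at hTh hreach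
    refine hreach ?_
    have h2 := hηH ω hω
    simp only [hσ, ENNReal.toNNReal_coe] at h2
    rw [← h2]
    refine measure_mono_null_ae ?_ h0
    filter_upwards [(hηlaw ω σ hσ).initial] with w hw hwr
    obtain ⟨t, ht, htB⟩ := exists_of_mem_reachingPaths hwr
    refine ⟨σ + t, ?_, ?_⟩
    · push_cast
      exact (add_le_add_right ht _).trans (add_tsub_cancel_of_le hTh).le
    · have h3 : (gluePath (T ω) (Y ω) w (σ + t)).1 ∈ B := by
        rw [hσ, gluePath_add, Prod.fst_add, Prod.fst_sub, ← hw]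
        simpa using htB
      exact h3
  simp only [reachability, ENNReal.iSup_eq_zero] at hx
  exact hpos (hx _ _ _ hF'.toCourse)

/-! ### Zero reachability as almost sure absence, and the proposition -/

lemma reachability_eq_zero_iff {B : Set (EuclideanSpace ℝ (Fin n))} {h : ℝ≥0∞}
    {x : EuclideanSpace ℝ (Fin n)} : D.reachability B h x = 0 ↔
      ∀ (Ω : Type) (_ : MeasurableSpace Ω) (P : Measure Ω) (S : D.Course x P),
        ∀ᵐ ω ∂P, ω ∉ S.occurs B h := by
  simp only [reachability, ENNReal.iSup_eq_zero, measure_eq_zero_iff_ae_notMem]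

end ControlledDiffusion

lemma DiscreteMDP.reachability_eq_zero_iff {E A : Type} [MeasurableSpace E] [MeasurableSpace A]
    {M : DiscreteMDP E A} {B : Set E} {h : ℕ∞} {x : E} : M.reachability B h x = 0 ↔
      ∀ (Ω : Type) (_ : MeasurableSpace Ω) (P : Measure Ω) (S : M.Course x P),
        ∀ᵐ ω ∂P, ω ∉ S.occurs B h := by
  simp only [reachability, ENNReal.iSup_eq_zero, measure_eq_zero_iff_ae_notMem]

theorem proposition2 :
    (∀ (n m : ℕ) (D : ControlledDiffusion n m) (B : Set (EuclideanSpace ℝ (Fin n))),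
      MeasurableSet B → B ⊆ D.terminal →
      ∀ (h : ℝ≥0∞) (x : EuclideanSpace ℝ (Fin n)),
        (D.reachability B h x = 0 →
          ∀ (Ω : Type) (_ : MeasurableSpace Ω) (P : Measure Ω) (S : D.Course x P),
            ∀ᵐ ω ∂P, ∀ t : ℝ≥0, (t : ℝ≥0∞) ≤ h → D.reachability B (h - t) (S.X t ω) = 0) ∧
        (D.reachability B h x = 0 ↔
          ∀ (Ω : Type) (_ : MeasurableSpace Ω) (P : Measure Ω) (S : D.Course x P),
            ∀ᵐ ω ∂P, ω ∉ S.occurs B h)) ∧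
    (∀ (E A : Type) [MeasurableSpace E] [StandardBorelSpace E]
      [MeasurableSpace A] [StandardBorelSpace A] (M : DiscreteMDP E A) (B : Set E),
      MeasurableSet B → B ⊆ M.terminal →
      ∀ (h : ℕ∞) (x : E),
        (M.reachability B h x = 0 →
          ∀ (Ω : Type) (_ : MeasurableSpace Ω) (P : Measure Ω) (S : M.Course x P),
            ∀ᵐ ω ∂P, ∀ k : ℕ, (k : ℕ∞) ≤ h → M.reachability B (h - k) (S.X k ω) = 0) ∧
        (M.reachability B h x = 0 ↔
          ∀ (Ω : Type) (_ : MeasurableSpace Ω) (P : Measure Ω) (S : M.Course x P),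
            ∀ᵐ ω ∂P, ω ∉ S.occurs B h)) := by
  refine ⟨fun n m D B hB hBF h x => ⟨fun hx Ω _ P S => ?_, ?_⟩,
    fun E A _ _ _ _ M B hB _ h x => ⟨fun hx Ω _ P S => ?_, ?_⟩⟩
  · exact ControlledDiffusion.reachability_remains_zero hB hBF hx S
  · exact ControlledDiffusion.reachability_eq_zero_iff
  · exact M.reachability_remains_zero hB hx S
  · exact DiscreteMDP.reachability_eq_zero_iff
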